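/- Let $\{0,1\}^*$ be the set of all binary strings (including the empty one). A partial function $f:\{0,1\}^*\to\{0,1\}^*$ is \emph{polynomially balanced} if there are polynomials $p,q$ such that $|f(x)|\le p(|x|)$ and $|x|\le q(|f(x)|)$ for all $x\in\mathrm{Dom}(f)$. It is \emph{polynomial-time computable} if some deterministic Turing machine halts on every input $x$ within a number of steps polynomial in $|x|$, accepts and outputs $f(x)$ if $x\in\mathrm{Dom}(f)$, and rejects if $x\notin\mathrm{Dom}(f)$. Let $\mathsf{fP}$ be the set of all polynomially balanced, polynomial-time computable partial functions $\{0,1\}^*\to\{0,1\}^*$. A partial function $f$ is \emph{(worst-case) one-way} if $f\in\mathsf{fP}$, but there is no deterministic polynomial-time algorithm which, on every input $y\in\mathrm{Im}(f)$, outputs some $x$ with $f(x)=y$ (nothing is required of the output for $y\notin\mathrm{Im}(f)$). An element $x$ of a semigroup $S$ is \emph{regular} if there is $x'\in S$ with $xx'x=x$, and $S$ is \emph{regular} if all its elements are. $\mathsf{P}$ and $\mathsf{NP}$ are the classes of languages over $\{0,1\}$ accepted by deterministic, respectively nondeterministic, polynomial-time Turing machines. Then $\mathsf{fP}$ is a monoid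 under composition of partial functions (with the identity map of $\{0,1\}^*$ as identity element), and 1. the monoid $\mathsf{fP}$ is regular if and only if one-way functions do not exist; 2. the monoid $\mathsf{fP}$ is regular if and only if $\mathsf{P}=\mathsf{NP}$; 3. the non-regular elements of $\mathsf{fP}$ are exactly the one-way functions. -/

import Mathlib

namespace PolyFun

/-- Binary strings, that is, the elements of the free monoid over `{0,1}`. -/
abbrev Str : Type := List Bool

/-! ### Semigroups -/

/-- The monoid of all partial functions on `α` under composition: `(f * g) x = f (g x)`. -/
instance instMonoidPFun {α : Type*} : Monoid (α →. α) where
  mul f g := f.comp g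
  one := PFun.id α
  mul_assoc f g h := PFun.comp_assoc f g h
  one_mul f := PFun.id_comp f
  mul_one f := PFun.comp_id f

/-- An element `x` of a semigroup is regular if `x x' x = x` for some element `x'`. -/
def IsRegularElement {S : Type*} [Semigroup S] (x : S) : Prop :=
  ∃ x' : S, x * x' * x = x

/-- A semigroup is regular if all its elements are. -/
def IsRegularSemigroup (S : Type*) [Semigroup S] : Prop :=
  ∀ x : S, IsRegularElement x

/-! ### Deterministic polynomial time -/

/-- The total function `g` on binary strings, with its values written as binary strings by `enc`,
is computed by a deterministic polynomial-time Turing machine. Mathlib's machines have finitely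
many stacks, labels and states; that all stack alphabets are finite is required here. -/
def DetPolyTime {β : Type} (enc : β → Str) (g : Str → β) : Prop :=
  ∃ C : Turing.TM2ComputableInPolyTime (id : Str → Str) enc g, ∀ k, Finite (C.tm.Γ k)

/-- How a machine for a partial function presents its result: a verdict bit (is the function
defined at the input?), followed by the value if there is one. -/
def encodeResult : Option Str → Str
  | none => [false]
  | some w => true :: w

/-- The partial function `f` is computed by a deterministic polynomial-time Turing machine. The
machine halts on every input within a polynomial number of steps, accepting with output `f x` if
`x` is in the domain of `f`, and rejecting otherwise. -/
def PolyTimeComputable (f : Str →. Str) : Prop :=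
  ∃ g : Str → Option Str, (∀ x, f x = (g x : Part Str)) ∧
    DetPolyTime encodeResult g

/-- The class `P`: the languages over `{0,1}` whose characteristic function is computed by a
deterministic polynomial-time Turing machine. -/
def ClassP : Set (Language Bool) :=
  {L | ∃ χ : Str → Bool, (∀ x, χ x = true ↔ x ∈ L) ∧
    DetPolyTime Computability.encodeBool χ}

/-! ### Nondeterministic polynomial time -/

/-- A nondeterministic Turing machine: as Mathlib's machines `Turing.FinTM2`, except that at each
label there is a finite set of statements to choose from. Input and output are binary. -/
structure NTM where
  /-- index type of the stacks -/
  {K : Type}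
  [decEqK : DecidableEq K]
  [finK : Fintype K]
  /-- input stack -/
  k₀ : K
  /-- output stack -/
  k₁ : K
  /-- stack alphabets -/
  Γ : K → Type
  [finΓ : ∀ k, Fintype (Γ k)]
  /-- labels -/
  Λ : Type
  [finΛ : Fintype Λ]
  /-- initial label -/
  main : Λ
  /-- internal states -/
  σ : Type
  [finσ : Fintype σ]
  initialState : σ
  /-- the statements that may be executed at a label -/
  m : Λ → Set (Turing.TM2.Stmt Γ Λ σ)
  finite_m : ∀ l, (m l).Finite
  inputAlphabet : Γ k₀ ≃ Bool
  outputAlphabet : Γ k₁ ≃ Bool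

namespace NTM

instance instDecidableEqK (N : NTM) : DecidableEq N.K := N.decEqK

variable (N : NTM)

/-- Configurations. -/
abbrev Cfg : Type := Turing.TM2.Cfg N.Γ N.Λ N.σ

/-- `c'` is a possible successor configuration of `c`. A configuration without a label has
halted. -/
def Step (c c' : N.Cfg) : Prop :=
  ∃ l ∈ c.l, ∃ q ∈ N.m l, c' = Turing.TM2.stepAux q c.var c.stk

/-- Some computation leads from one configuration to the other in exactly the given number
of steps. -/
def StepsIn : ℕ → N.Cfg → N.Cfg → Prop
  | 0, c, c' => c = c'
  | n + 1, c, c' => ∃ d, N.Step c d ∧ StepsIn n d c'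

/-- The initial configuration on the input `x`. -/
def init (x : Str) : N.Cfg :=
  { l := some N.main
    var := N.initialState
    stk := Function.update (fun _ => []) N.k₀ (x.map N.inputAlphabet.symm) }

/-- An accepting configuration has halted, with output `1`. -/
def IsAccepting (c : N.Cfg) : Prop :=
  c.l = none ∧ c.stk N.k₁ = [N.outputAlphabet.symm true]

/-- The machine accepts `x` if at least one of its computations on `x` does. -/
def Accepts (x : Str) : Prop :=
  ∃ n c, N.StepsIn n (N.init x) c ∧ N.IsAccepting c

/-- All computations of the machine are polynomially bounded in the length of the input. -/
def IsPolyTime : Prop :=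
  ∃ p : Polynomial ℕ, ∀ x n c, N.StepsIn n (N.init x) c → n ≤ p.eval x.length

end NTM

/-- The class `NP`: the languages over `{0,1}` accepted by nondeterministic polynomial-time
Turing machines. -/
def ClassNP : Set (Language Bool) :=
  {L | ∃ N : NTM, N.IsPolyTime ∧ ∀ x, N.Accepts x ↔ x ∈ L}

/-! ### The functions -/

/-- Input length and output length bound each other polynomially. -/
def PolyBalanced (f : Str →. Str) : Prop :=
  ∃ p q : Polynomial ℕ, ∀ x, ∀ y ∈ f x,
    y.length ≤ p.eval x.length ∧ x.length ≤ q.eval y.length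

/-- The set `fP` of polynomially balanced, polynomial-time computable partial functions. -/
def fP : Set (Str →. Str) :=
  {f | PolyBalanced f ∧ PolyTimeComputable f}

/-- Worst-case one-way functions: `f` is in `fP`, but no deterministic polynomial-time algorithm
outputs, on every input `y` in the image of `f`, some `x` with `f x = y`. -/
def IsOneWay (f : Str →. Str) : Prop :=
  f ∈ fP ∧ ¬ ∃ g : Str →. Str, PolyTimeComputable g ∧ ∀ y ∈ f.ran, ∃ x ∈ g y, y ∈ f x

end PolyFun

namespace PolyFun

open Turing TM2 Polynomial

/-! ### Polynomial bounds -/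

/-! Regularity and one-wayness. If `f * g * f = f`, then `g` maps each `y` in the image of `f` to
some preimage, so `f` is not one-way. Conversely, let `g` be a polynomial-time inverter of `f`.
Outside the image, `g` may answer anything, so it need not be balanced. The partial function that
runs `g`, checks `f (g y) = y` and rejects on failure consists only of reversed pairs of `f`. It is
therefore balanced, with the polynomials of `f` swapped, and it is an inverse of `f` inside `fP`
(`exists_inverse`, `isRegularElement_iff`). Its domain is exactly the image of `f`.

No one-way functions implies `NP ⊆ P`. For a nondeterministic polynomial-time machine, the map
sending an encoded accepting computation to its input lies in `fP`, and its image is the accepted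
language (`NTM.inputOf_mem_fP`). The verdict bit of the checked inverse decides that image
(`mem_classP_of_ran`).

`P = NP` implies that inverters exist. The question whether a given prefix extends to a preimage of
`y` is in `NP`, by guess and verify (`guess_mem_classNP`, `query_guess_iff`). If it is decidable in
polynomial time, a preimage is found bit by bit (`search_correct`). Queries are padded so that a
guess as long as the query has room for any possible suffix.

The rest is programming. `Emb` runs one stack machine inside another, step by step. `RM.graph`
combines register machines into flow charts, and `Tr` is the resulting calculus of polynomial-time
register transformations, with composition, branching, loops and subroutine calls. -/

theorem eval_mono (p : ℕ[X]) {a b : ℕ} (h : a ≤ b) : p.eval a ≤ p.eval b := by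
  induction p using Polynomial.induction_on' with
  | add p q hp hq => simpa using add_le_add hp hq
  | monomial n c => simpa using Nat.mul_le_mul_left c (Nat.pow_le_pow_left h n)

/-! ### Counting the steps of a machine -/

section Runs

variable {K Λ σ : Type} [DecidableEq K] {Γ : K → Type}

/-- The machine `m` goes from one configuration to the other in exactly the given number of
steps. -/
def Runs (m : Λ → Stmt Γ Λ σ) : ℕ → Cfg Γ Λ σ → Cfg Γ Λ σ → Prop
  | 0, c, c' => c = c'
  | n + 1, c, c' => ∃ d, TM2.step m c = some d ∧ Runs m n d c'

theorem Runs.trans {m : Λ → Stmt Γ Λ σ} {a b : ℕ} {c d e : Cfg Γ Λ σ}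
    (h₁ : Runs m a c d) (h₂ : Runs m b d e) : Runs m (a + b) c e := by
  induction a generalizing c with
  | zero => cases h₁; simpa using h₂
  | succ a ih =>
    obtain ⟨f, hf, h⟩ := h₁
    rw [Nat.succ_add]
    exact ⟨f, hf, ih h⟩

theorem Runs.single {m : Λ → Stmt Γ Λ σ} {c d : Cfg Γ Λ σ} (h : TM2.step m c = some d) :
    Runs m 1 c d := ⟨d, h, rfl⟩

theorem Runs.of_stepAux {m : Λ → Stmt Γ Λ σ} {l : Λ} {v : σ} {S : ∀ k, List (Γ k)}
    {d : Cfg Γ Λ σ} (h : stepAux (m l) v S = d) : Runs m 1 ⟨some l, v, S⟩ d :=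
  Runs.single (by rw [← h]; rfl)

/-- Mathlib's evaluation iterates the step function on `Option`, where `none` is absorbing. Reaching
`some d` thus means that no step failed on the way. -/
theorem runs_iff_iterate {m : Λ → Stmt Γ Λ σ} {n : ℕ} {c d : Cfg Γ Λ σ} :
    Runs m n c d ↔ (flip bind (TM2.step m))^[n] (some c) = some d := by
  induction n generalizing c with
  | zero => simp [Runs]
  | succ n ih =>
    rw [Function.iterate_succ_apply]
    have hn : ∀ n : ℕ, (flip bind (TM2.step m))^[n] none = none := by
      intro n
      induction n with
      | zero => rfl
      | succ n ih => rw [Function.iterate_succ_apply]; exact ih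
    have : flip bind (TM2.step m) (some c) = TM2.step m c := rfl
    rw [this]
    simp only [Runs]
    cases h : TM2.step m c with
    | none => rw [hn]; simp
    | some e => simp [ih]

/-- The number of symbols that a statement can push. -/
def pushes : Stmt Γ Λ σ → ℕ
  | Stmt.push _ _ q => pushes q + 1
  | Stmt.peek _ _ q => pushes q
  | Stmt.pop _ _ q => pushes q
  | Stmt.load _ q => pushes q
  | Stmt.branch _ q₁ q₂ => pushes q₁ + pushes q₂
  | Stmt.goto _ => 0
  | Stmt.halt => 0

/-- `pushes` adds up both arms of a branch, which is crude but sufficient for an upper bound. -/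
theorem length_stepAux_le (q : Stmt Γ Λ σ) (v : σ) (S : ∀ k, List (Γ k)) (k : K) :
    ((stepAux q v S).stk k).length ≤ (S k).length + pushes q := by
  induction q generalizing v S with
  | push k' f q ih =>
    simp only [stepAux, pushes]
    refine (ih _ _).trans ?_
    by_cases h : k = k'
    · subst h; simp only [Function.update_self, List.length_cons]; omega
    · rw [Function.update_of_ne h]; omega
  | peek k' f q ih => exact ih _ _
  | pop k' f q ih =>
    simp only [stepAux, pushes]
    refine (ih _ _).trans ?_
    by_cases h : k = k'
    · subst h; simp
    · simp [Function.update_of_ne h]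
  | load f q ih => exact ih _ _
  | branch p q₁ q₂ ih₁ ih₂ =>
    simp only [stepAux, pushes]
    cases p v
    · exact (ih₂ _ _).trans (by omega)
    · exact (ih₁ _ _).trans (by omega)
  | goto l => simp [pushes]
  | halt => simp [pushes]

/-- There are finitely many labels, so the number of symbols pushed in one step has a uniform bound
`C`. This bounds the output of a subroutine and the time needed to clean up after it. -/
theorem exists_length_le_of_runs [Finite Λ] (m : Λ → Stmt Γ Λ σ) :
    ∃ C, ∀ n c d, Runs m n c d → ∀ k, (d.stk k).length ≤ (c.stk k).length + C * n := by
  obtain ⟨C, hC⟩ := (Set.finite_range fun l => pushes (m l)).bddAbove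
  refine ⟨C, fun n c d h k => ?_⟩
  induction n generalizing c with
  | zero => cases h; simp
  | succ n ih =>
    obtain ⟨e, he, h⟩ := h
    refine (ih e h).trans ?_
    obtain ⟨l, v, S⟩ := c
    cases l with
    | none => simp at he
    | some l =>
      simp only [step, Option.some.injEq] at he
      subst he
      have := length_stepAux_le (m l) v S k
      have h2 : pushes (m l) ≤ C := hC ⟨l, rfl⟩
      simp only
      rw [Nat.mul_succ]
      omega

end Runs

/-! ### Running a machine inside another one -/

/-- An embedding of the stacks, labels and states of a machine into those of another one. When the
first machine halts, the second one continues at the label `ex`, or halts if there is none. -/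
structure Emb {K K' : Type} (Γ : K → Type) (Γ' : K' → Type) (Λ Λ' σ σ' : Type) where
  /-- the stacks -/
  e : K → K'
  inj : Function.Injective e
  /-- the symbols -/
  φ : ∀ k, Γ k ≃ Γ' (e k)
  /-- the labels -/
  lab : Λ → Λ'
  /-- the exit -/
  ex : Option Λ'
  /-- the part of the state that belongs to the first machine -/
  get : σ' → σ
  /-- replacement of that part -/
  set : σ' → σ → σ'
  get_set : ∀ v s, get (set v s) = s
  set_set : ∀ v s t, set (set v s) t = set v t

namespace Emb

variable {K K' Λ Λ' σ σ' : Type} [DecidableEq K] [DecidableEq K'] {Γ : K → Type} {Γ' : K' → Type}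
  (E : Emb Γ Γ' Λ Λ' σ σ')

/-- Translation of statements. -/
def tr : Stmt Γ Λ σ → Stmt Γ' Λ' σ'
  | Stmt.push k f q => Stmt.push (E.e k) (fun v => E.φ k (f (E.get v))) (tr q)
  | Stmt.peek k f q =>
    Stmt.peek (E.e k) (fun v o => E.set v (f (E.get v) (o.map (E.φ k).symm))) (tr q)
  | Stmt.pop k f q =>
    Stmt.pop (E.e k) (fun v o => E.set v (f (E.get v) (o.map (E.φ k).symm))) (tr q)
  | Stmt.load a q => Stmt.load (fun v => E.set v (a (E.get v))) (tr q)
  | Stmt.branch p q₁ q₂ => Stmt.branch (fun v => p (E.get v)) (tr q₁) (tr q₂)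
  | Stmt.goto f => Stmt.goto fun v => E.lab (f (E.get v))
  | Stmt.halt => match E.ex with
    | none => Stmt.halt
    | some l => Stmt.goto fun _ => l

/-- A configuration of the second machine that represents one of the first. -/
structure Rel (v₀ : σ') (S₀ : ∀ k, List (Γ' k)) (c : Cfg Γ Λ σ) (c' : Cfg Γ' Λ' σ') : Prop where
  l : c'.l = c.l.elim E.ex fun l => some (E.lab l)
  var : c'.var = E.set v₀ c.var
  stk : ∀ k, c'.stk (E.e k) = (c.stk k).map (E.φ k)
  stk_of_notMem : ∀ k', k' ∉ Set.range E.e → c'.stk k' = S₀ k'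

/-- The translation acts through the bijections `φ` on embedded stacks and never mentions the
others, which keep the contents `S₀`. Halting is the only place where the translation changes
control, and it becomes the exit. -/
theorem rel_stepAux {v₀ : σ'} {S₀ : ∀ k, List (Γ' k)} (q : Stmt Γ Λ σ) (v : σ)
    (S : ∀ k, List (Γ k)) (S' : ∀ k, List (Γ' k)) (h : ∀ k, S' (E.e k) = (S k).map (E.φ k))
    (h' : ∀ k', k' ∉ Set.range E.e → S' k' = S₀ k') :
    E.Rel v₀ S₀ (stepAux q v S) (stepAux (E.tr q) (E.set v₀ v) S') := by
  induction q generalizing v S S' with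
  | push k f q ih =>
    simp only [tr, stepAux]
    refine ih _ _ _ (fun k₁ => ?_) (fun k' hk' => ?_)
    · by_cases hk : k₁ = k
      · subst hk; simp [h, E.get_set]
      · rw [Function.update_of_ne hk, Function.update_of_ne (fun e => hk (E.inj e)), h]
    · rw [Function.update_of_ne (by rintro rfl; exact hk' ⟨k, rfl⟩), h' _ hk']
  | peek k f q ih =>
    simp only [tr, stepAux, E.set_set, E.get_set, h]
    have : ((S k).map (E.φ k)).head?.map (E.φ k).symm = (S k).head? := by
      cases S k <;> simp
    rw [this]
    exact ih _ _ _ h h'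
  | pop k f q ih =>
    simp only [tr, stepAux, E.set_set, E.get_set, h]
    have : ((S k).map (E.φ k)).head?.map (E.φ k).symm = (S k).head? := by
      cases S k <;> simp
    rw [this]
    refine ih _ _ _ (fun k₁ => ?_) (fun k' hk' => ?_)
    · by_cases hk : k₁ = k
      · subst hk; simp
      · rw [Function.update_of_ne hk, Function.update_of_ne (fun e => hk (E.inj e)), h]
    · rw [Function.update_of_ne (by rintro rfl; exact hk' ⟨k, rfl⟩), h' _ hk']
  | load a q ih =>
    simp only [tr, stepAux, E.set_set, E.get_set]
    exact ih _ _ _ h h'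
  | branch p q₁ q₂ ih₁ ih₂ =>
    simp only [tr, stepAux, E.get_set]
    cases p v
    · exact ih₂ _ _ _ h h'
    · exact ih₁ _ _ _ h h'
  | goto f =>
    simp only [tr, stepAux, E.get_set]
    exact ⟨rfl, rfl, h, h'⟩
  | halt =>
    simp only [tr, stepAux]
    cases hx : E.ex with
    | none => exact ⟨by simp [hx], rfl, h, h'⟩
    | some l => exact ⟨by simp [hx], rfl, h, h'⟩

/-- The number of steps is preserved exactly, because each label is translated to a single label and
the jump to the exit belongs to the halting statement. -/
theorem Rel.runs {E : Emb Γ Γ' Λ Λ' σ σ'} {v₀ : σ'} {S₀ : ∀ k, List (Γ' k)}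
    {m : Λ → Stmt Γ Λ σ} {m' : Λ' → Stmt Γ' Λ' σ'} (hm : ∀ l, m' (E.lab l) = E.tr (m l))
    {n : ℕ} {c d : Cfg Γ Λ σ} {c' : Cfg Γ' Λ' σ'} (hc : E.Rel v₀ S₀ c c') (h : Runs m n c d) :
    ∃ d', Runs m' n c' d' ∧ E.Rel v₀ S₀ d d' := by
  induction n generalizing c c' with
  | zero => cases h; exact ⟨c', rfl, hc⟩
  | succ n ih =>
    obtain ⟨e, he, h⟩ := h
    obtain ⟨l, v, S⟩ := c
    cases l with
    | none => simp at he
    | some l =>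
      simp only [step, Option.some.injEq] at he
      subst he
      obtain ⟨l', v', S'⟩ := c'
      obtain ⟨h1, h2, h3, h4⟩ := hc
      simp only [Option.elim] at h1 h2 h3 h4
      subst h1 h2
      obtain ⟨d', hd', hr⟩ := ih (E.rel_stepAux (v₀ := v₀) (S₀ := S₀) (m l) v S S' h3 h4) h
      exact ⟨d', ⟨_, by rw [step, hm], hd'⟩, hr⟩

end Emb

/-! ### Register machines -/

/-- The stack alphabets of a register machine: registers hold binary strings. -/
@[reducible] def Alph (R : Type) {P : Type} (Γ : P → Type) : R ⊕ P → Type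
  | Sum.inl _ => Bool
  | Sum.inr p => Γ p

/-- The stacks of a register machine whose private stacks are empty. -/
def regs {R P : Type} {Γ : P → Type} (S : R → Str) : ∀ k, List (Alph R Γ k)
  | Sum.inl r => S r
  | Sum.inr _ => []

/-- A machine with registers indexed by `R` and private stacks indexed by `P`. -/
structure RM (R : Type) where
  /-- index type of the private stacks -/
  {P : Type}
  [decP : DecidableEq P]
  [finP : Finite P]
  /-- alphabets of the private stacks -/
  Γ : P → Type
  [finΓ : ∀ p, Finite (Γ p)]
  /-- labels -/
  Λ : Type
  [finΛ : Finite Λ]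
  /-- initial label -/
  main : Λ
  /-- internal states -/
  σ : Type
  [finσ : Finite σ]
  /-- initial and final state -/
  ini : σ
  /-- the program -/
  m : Λ → Stmt (Alph R Γ) Λ σ

namespace RM

variable {R : Type} [DecidableEq R]

instance (M : RM R) : DecidableEq M.P := M.decP
instance (M : RM R) : Finite M.P := M.finP
instance (M : RM R) (p : M.P) : Finite (M.Γ p) := M.finΓ p
instance (M : RM R) : Finite M.Λ := M.finΛ
instance (M : RM R) : Finite M.σ := M.finσ

/-- The machine takes the register contents `S` to `T` in `n` steps. -/
def Computes (M : RM R) (n : ℕ) (S T : R → Str) : Prop :=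
  Runs M.m n ⟨some M.main, M.ini, regs S⟩ ⟨none, M.ini, regs T⟩

/-! ### Flow charts -/

section Graph

variable {V : Type} [Finite V] [DecidableEq V] (M : V → RM R) (reg : V → R)
  (nxt : V → Option Bool → Option V) (v₀ : V)

/-- A node of a flow chart as a part of it. -/
def graphEmb (v : V) : Emb (Alph R (M v).Γ) (Alph R fun p : Σ v, (M v).P => (M p.1).Γ p.2)
    (M v).Λ ((Σ v, (M v).Λ) ⊕ V) (M v).σ ((∀ v, (M v).σ) × Option Bool) where
  e := Sum.map id (Sigma.mk (β := fun v => (M v).P) v)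
  inj := Function.Injective.sumMap Function.injective_id sigma_mk_injective
  φ := fun k => match k with
    | Sum.inl _ => Equiv.refl _
    | Sum.inr _ => Equiv.refl _
  lab l := Sum.inl ⟨v, l⟩
  ex := some (Sum.inr v)
  get s := s.1 v
  set s t := (Function.update s.1 v t, s.2)
  get_set := by simp
  set_set := by simp

/-- The flow chart whose node `v` runs the machine `M v`, and then jumps to a node, or halts,
depending on the first symbol of the register `reg v`. -/
def graph : RM R where
  P := Σ v, (M v).P
  Γ p := (M p.1).Γ p.2
  Λ := (Σ v, (M v).Λ) ⊕ V
  main := Sum.inl ⟨v₀, (M v₀).main⟩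
  σ := (∀ v, (M v).σ) × Option Bool
  ini := (fun v => (M v).ini, none)
  m
    | Sum.inl l => (graphEmb M l.1).tr ((M l.1).m l.2)
    | Sum.inr v =>
      Stmt.peek (Sum.inl (reg v)) (fun s o => (s.1, o)) <|
      Stmt.branch (fun s => (nxt v s.2).isSome)
        (Stmt.goto fun s => (nxt v s.2).elim (Sum.inr v) fun w => Sum.inl ⟨w, (M w).main⟩)
        (Stmt.load (fun s => (s.1, none)) Stmt.halt)

/-- The flow chart about to run the node `v`, or halted. -/
def graphCfg (v : Option V) (o : Option Bool) (S : R → Str) :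
    Cfg (Alph R (graph M reg nxt v₀).Γ) (graph M reg nxt v₀).Λ (graph M reg nxt v₀).σ :=
  ⟨v.map fun v => Sum.inl ⟨v, (M v).main⟩, (fun v => (M v).ini, o), regs S⟩

/-- The additional step is the jump at the label `Sum.inr v`. Since `Computes` ends in the initial
state, every node can be entered again later. The scratch bit `o` left by the peek is harmless, but
it must be `none` on halting for the final state to be the initial one. -/
theorem runs_graph {v : V} {n : ℕ} {S T : R → Str} (o : Option Bool) (h : (M v).Computes n S T) :
    ∃ o', Runs (graph M reg nxt v₀).m (n + 1) (graphCfg M reg nxt v₀ (some v) o S)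
      (graphCfg M reg nxt v₀ (nxt v (T (reg v)).head?) o' T) ∧
      (nxt v (T (reg v)).head? = none → o' = none) := by
  obtain ⟨⟨l, w, U⟩, hd, h1, h2, h3, h4⟩ := Emb.Rel.runs (E := graphEmb M v)
    (m' := (graph M reg nxt v₀).m) (v₀ := (fun v => (M v).ini, o)) (S₀ := fun _ => [])
    (c' := graphCfg M reg nxt v₀ (some v) o S) (fun l => rfl)
    ⟨rfl, by simp [graphCfg, graphEmb], by
      rintro (r | p)
      · exact (List.map_id _).symm
      · rfl, by
      rintro (r | p) hp
      · exact (hp ⟨Sum.inl r, rfl⟩).elim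
      · rfl⟩ h
  -- Private stacks of the other nodes lie outside the range of the embedding, so they are still
  -- empty.
  have hU : U = regs T := by
    funext k
    obtain r | ⟨v', p⟩ := k
    · exact (h3 (Sum.inl r)).trans (List.map_id _)
    · by_cases hv : v' = v
      · subst hv
        exact h3 (Sum.inr p)
      · refine h4 _ ?_
        rintro ⟨r | p', hp⟩
        · cases hp
        · cases hp
          exact hv rfl
  simp only [graphEmb, Option.elim] at h1 h2
  subst h1 h2 hU
  simp only [Function.update_eq_self] at hd
  cases hx : nxt v (T (reg v)).head? with
  | none =>
    refine ⟨none, hd.trans (Runs.of_stepAux ?_), fun _ => rfl⟩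
    simp [graph, graphCfg, regs, hx]
  | some w =>
    refine ⟨(T (reg v)).head?, hd.trans (Runs.of_stepAux ?_), by simp⟩
    simp [graph, graphCfg, regs, hx]

end Graph
end RM

set_option linter.unusedSectionVars false

/-! ### Polynomial-time transformations of the registers -/

section Tr

variable {α β R : Type} [Fintype R] [DecidableEq R] [Inhabited R]

/-- The total length of the registers. -/
def size (S : R → Str) : ℕ := ∑ r, (S r).length

/-- Some register machine takes the register contents `s a` to `t a` in polynomial time, for all
parameters `a` that satisfy the precondition `D`. -/
def Tr (D : α → Prop) (s t : α → R → Str) : Prop :=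
  ∃ (M : RM R) (p : ℕ[X]), ∀ a, D a → size (t a) ≤ p.eval (size (s a)) ∧
    ∃ n ≤ p.eval (size (s a)), M.Computes n (s a) (t a)

namespace Tr

variable {D D' : α → Prop} {s t u : α → R → Str}

theorem congr (h : Tr D s t) {s' t' : α → R → Str} (hD : ∀ a, D' a → D a)
    (hs : ∀ a, D' a → s a = s' a) (ht : ∀ a, D' a → t a = t' a) : Tr D' s' t' := by
  obtain ⟨M, p, h⟩ := h
  refine ⟨M, p, fun a ha => ?_⟩
  rw [← hs a ha, ← ht a ha]
  exact h a (hD a ha)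

theorem mono (h : Tr D s t) (hD : ∀ a, D' a → D a) : Tr D' s t :=
  h.congr hD (fun _ _ => rfl) fun _ _ => rfl

theorem to_eq (h : Tr D s t) {t' : α → R → Str} (ht : ∀ a, D a → t a = t' a) : Tr D s t' :=
  h.congr (fun _ h => h) (fun _ _ => rfl) ht

theorem comap (h : Tr D s t) (φ : β → α) : Tr (fun b => D (φ b)) (fun b => s (φ b))
    (fun b => t (φ b)) := by
  obtain ⟨M, p, h⟩ := h
  exact ⟨M, p, fun b hb => h _ hb⟩

theorem refl (D : α → Prop) (s : α → R → Str) : Tr D s s :=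
  ⟨⟨(fun _ : Empty => Unit), Unit, (), Unit, (), fun _ => Stmt.halt⟩, X + 1,
    fun a _ => ⟨by simp, 1, by simp, Runs.of_stepAux rfl⟩⟩

/-- A flow chart with two nodes. The second machine is fast in terms of the size of its own input `t
a`. That is why `Tr` also bounds the size of the result, and why `q.comp p` appears. -/
theorem trans (h₁ : Tr D s t) (h₂ : Tr D t u) : Tr D s u := by
  obtain ⟨M, p, h₁⟩ := h₁
  obtain ⟨N, q, h₂⟩ := h₂
  let f : Bool → RM R := fun v => cond v N M
  let nxt : Bool → Option Bool → Option Bool := fun v _ => cond v none (some true)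
  refine ⟨RM.graph f (fun _ => default) nxt false, p + q.comp p + 2, fun a ha => ?_⟩
  obtain ⟨hs, n, hn, hr⟩ := h₁ a ha
  obtain ⟨hs', n', hn', hr'⟩ := h₂ a ha
  have hq := eval_mono q hs
  obtain ⟨o, ho, -⟩ := RM.runs_graph f (fun _ => default) nxt false (v := false) none hr
  obtain ⟨o', ho', ho''⟩ := RM.runs_graph f (fun _ => default) nxt false (v := true) o hr'
  cases ho'' rfl
  have e : (p + q.comp p + 2).eval (size (s a)) =
      p.eval (size (s a)) + q.eval (p.eval (size (s a))) + 2 := by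
    simp [Polynomial.eval_comp]
  rw [e]
  exact ⟨by omega, _, by omega, ho.trans ho'⟩

/-- A flow chart inspects a register only after running a node, so the entry node `none` does
nothing, and its jump selects one of three machines: for an empty register and for each first
symbol. -/
theorem cases (r : R) (h : ∀ o, Tr (fun a => D a ∧ (s a r).head? = o) s t) : Tr D s t := by
  choose M p h using h
  obtain ⟨M₀, p₀, h₀⟩ := refl D s
  let f : Option (Option Bool) → RM R := fun v => v.elim M₀ M
  let nxt : Option (Option Bool) → Option Bool → Option (Option (Option Bool)) :=
    fun v o => v.elim (some (some o)) fun _ => none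
  refine ⟨RM.graph f (fun _ => r) nxt none, p₀ + ∑ o, p o + 2, fun a ha => ?_⟩
  obtain ⟨hs, n, hn, hr⟩ := h₀ a ha
  obtain ⟨hs', n', hn', hr'⟩ := h (s a r).head? a ⟨ha, rfl⟩
  obtain ⟨o, ho, -⟩ := RM.runs_graph f (fun _ => r) nxt none (v := none) none hr
  obtain ⟨o', ho', ho''⟩ := RM.runs_graph f (fun _ => r) nxt none
    (v := some (s a r).head?) o hr'
  cases ho'' rfl
  have e : (p₀ + ∑ o, p o + 2).eval (size (s a)) =
      p₀.eval (size (s a)) + ∑ o, (p o).eval (size (s a)) + 2 := by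
    simp
  have := Finset.single_le_sum (f := fun o => (p o).eval (size (s a))) (fun _ _ => Nat.zero_le _)
    (Finset.mem_univ (s a r).head?)
  rw [e]
  exact ⟨by omega, _, by omega, ho.trans ho'⟩

/-- A loop that ends when the register `r` is empty. The function `μ` bounds the size of the
registers, and does not increase. -/
theorem loop (r : R) {s : β → R → Str} (next fin : β → β)
    (body : Tr (fun b => s b r ≠ []) s fun b => s (next b))
    (fin_nil : ∀ b, s b r = [] → fin b = b)
    (fin_next : ∀ b, s b r ≠ [] → fin (next b) = fin b)
    (dec : ∀ b, s b r ≠ [] → (s (next b) r).length < (s b r).length)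
    (μ : β → ℕ) (size_le : ∀ b, size (s b) ≤ μ b) (μ_next : ∀ b, s b r ≠ [] → μ (next b) ≤ μ b)
    (q : ℕ[X]) (μ_le : ∀ b, μ b ≤ q.eval (size (s b))) :
    Tr (fun _ => True) s fun b => s (fin b) := by
  obtain ⟨M, p, h⟩ := body
  obtain ⟨M₀, p₀, h₀⟩ := refl (fun _ => True) s
  let f : Bool → RM R := fun v => cond v M M₀
  let nxt : Bool → Option Bool → Option Bool := fun _ o => o.map fun _ => true
  -- The run starts just after a jump, when it is already decided whether another round follows. The
  -- scratch bit is known to be `none` only if the loop is over. At most `k` rounds follow, each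
  -- with one jump.
  have main : ∀ k b o, (s b r).length = k → size (s (fin b)) ≤ μ b ∧
      ∃ n ≤ k * (p.eval (μ b) + 1), Runs (RM.graph f (fun _ => r) nxt false).m n
        (RM.graphCfg f (fun _ => r) nxt false ((s b r).head?.map fun _ => true)
          (if s b r = [] then none else o) (s b))
        (RM.graphCfg f (fun _ => r) nxt false none none (s (fin b))) := by
    intro k
    induction k using Nat.strong_induction_on with
    | _ k ih =>
      intro b o hk
      by_cases hb : s b r = []
      · rw [fin_nil b hb]
        refine ⟨size_le b, 0, Nat.zero_le _, ?_⟩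
        simp [hb, Runs]
      · obtain ⟨hs, n, hn, hr⟩ := h b hb
        obtain ⟨o', ho', ho''⟩ := RM.runs_graph f (fun _ => r) nxt false (v := true) o hr
        have hd := dec b hb
        obtain ⟨h1, n', hn', hr'⟩ := ih _ (hk ▸ hd) (next b) o' rfl
        rw [fin_next b hb] at h1 hr'
        refine ⟨h1.trans (μ_next b hb), n + 1 + n', ?_, ?_⟩
        · have h2 := eval_mono p (size_le b)
          have h3 := eval_mono p (μ_next b hb)
          have h4 : n' ≤ (s (next b) r).length * (p.eval (μ b) + 1) :=
            hn'.trans (Nat.mul_le_mul_left _ (by omega))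
          have h5 : ((s (next b) r).length + 1) * (p.eval (μ b) + 1) ≤ k * (p.eval (μ b) + 1) :=
            Nat.mul_le_mul_right _ (by omega)
          rw [Nat.succ_mul] at h5
          omega
        · have e1 : ((s b r).head?.map fun _ => true) = some true := by
            cases hx : s b r with
            | nil => exact (hb hx).elim
            | cons => rfl
          rw [e1, if_neg hb]
          refine ho'.trans ?_
          have e2 : (if s (next b) r = [] then none else o') = o' := by
            split_ifs with hx
            · exact (ho'' (by simp [nxt, hx])).symm
            · rfl
          rw [e2] at hr'
          exact hr'
  -- `q` bounds the final size, `p₀ + 1` pays for the entry node and its jump, and `X` bounds the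
  -- number of rounds, whose sizes stay below `q`.
  refine ⟨RM.graph f (fun _ => r) nxt false, q + p₀ + 1 + X * (p.comp q + 1), fun b _ => ?_⟩
  obtain ⟨-, n, hn, hr⟩ := h₀ b trivial
  obtain ⟨o, ho, ho''⟩ := RM.runs_graph f (fun _ => r) nxt false (v := false) none hr
  obtain ⟨h1, n', hn', hr'⟩ := main _ b o rfl
  have e : (q + p₀ + 1 + X * (p.comp q + 1)).eval (size (s b)) = q.eval (size (s b)) +
      p₀.eval (size (s b)) + 1 + size (s b) * (p.eval (q.eval (size (s b))) + 1) := by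
    simp [Polynomial.eval_comp]
  rw [e]
  have h2 : (s b r).length ≤ size (s b) :=
    Finset.single_le_sum (f := fun r => (s b r).length) (fun _ _ => Nat.zero_le _)
      (Finset.mem_univ r)
  have h3 := Nat.mul_le_mul h2 (Nat.succ_le_succ (eval_mono p (μ_le b)))
  have h4 := μ_le b
  simp only [Nat.succ_eq_add_one] at h3
  have h5 := h1.trans h4
  refine ⟨by beta_reduce; omega, n + 1 + n', by omega, ho.trans ?_⟩
  have e2 : (if s b r = [] then none else o) = o := by
    split_ifs with hx
    · exact (ho'' (by simp [nxt, hx])).symm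
    · rfl
  rw [e2] at hr'
  exact hr'

/-- The additive form avoids truncated subtraction and suits `omega`. -/
theorem size_update (S : R → Str) (r : R) (x : Str) :
    size (Function.update S r x) + (S r).length = size S + x.length := by
  unfold size
  rw [← Finset.add_sum_erase _ _ (Finset.mem_univ r),
    ← Finset.add_sum_erase Finset.univ (fun r => (S r).length) (Finset.mem_univ r)]
  have : ∑ r' ∈ Finset.univ.erase r, (Function.update S r x r').length =
      ∑ r' ∈ Finset.univ.erase r, (S r').length :=
    Finset.sum_congr rfl fun r' hr' => by rw [Function.update_of_ne (Finset.ne_of_mem_erase hr')]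
  rw [this]
  simp
  omega

theorem regs_update {P : Type} [DecidableEq P] {Γ : P → Type} (S : R → Str) (r : R) (x : Str) :
    regs (Γ := Γ) (Function.update S r x) = Function.update (regs S) (Sum.inl r) x := by
  funext k
  obtain k | p := k
  · by_cases h : k = r
    · subst h; simp [regs]
    · simp [regs, h]
  · simp [regs]

theorem push (D : α → Prop) (s : α → R → Str) (r : R) (b : Bool) :
    Tr D s fun a => Function.update (s a) r (b :: s a r) := by
  refine ⟨⟨(fun _ : Empty => Unit), Unit, (), Unit, (),
    fun _ => Stmt.push (Sum.inl r) (fun _ => b) Stmt.halt⟩, X + 1, fun a _ => ⟨?_, 1,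
    by simp, Runs.of_stepAux ?_⟩⟩
  · have := size_update (s a) r (b :: s a r)
    simp at this ⊢
    omega
  · rw [regs_update]; rfl

theorem pop (D : α → Prop) (s : α → R → Str) (r : R) :
    Tr D s fun a => Function.update (s a) r (s a r).tail := by
  refine ⟨⟨(fun _ : Empty => Unit), Unit, (), Unit, (),
    fun _ => Stmt.pop (Sum.inl r) (fun _ _ => ()) Stmt.halt⟩, X + 1, fun a _ => ⟨?_, 1,
    by simp, Runs.of_stepAux ?_⟩⟩
  · have := size_update (s a) r (s a r).tail
    simp at this ⊢
    omega
  · rw [regs_update]; rfl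

end Tr

end Tr

/-! ### Subroutines -/

/-- The total function `h` on binary strings is computed by a deterministic polynomial-time
machine. -/
def PT (h : Str → Str) : Prop := DetPolyTime id h

/-- The function `h` is computed by a deterministic polynomial-time machine that may leave symbols
on all stacks but the output stack. -/
def Sloppy (h : Str → Str) : Prop :=
  ∃ (tm : FinTM2) (_ : ∀ k, Finite (tm.Γ k)) (i : tm.Γ tm.k₀ ≃ Bool) (o : tm.Γ tm.k₁ ≃ Bool)
    (p : ℕ[X]), ∀ x, ∃ n ≤ p.eval x.length, ∃ (v : tm.σ) (T : ∀ k, List (tm.Γ k)),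
      Runs tm.m n ⟨some tm.main, tm.initialState,
        Function.update (fun _ => []) tm.k₀ (x.map i.symm)⟩ ⟨none, v, T⟩ ∧
      T tm.k₁ = (h x).map o.symm

theorem initList_eq (tm : FinTM2) (s : List (tm.Γ tm.k₀)) :
    initList tm s = ⟨some tm.main, tm.initialState, Function.update (fun _ => []) tm.k₀ s⟩ := by
  unfold initList
  congr 1
  funext k
  by_cases h : k = tm.k₀
  · subst h; simp
  · simp [h]

theorem haltList_eq (tm : FinTM2) (s : List (tm.Γ tm.k₁)) :
    haltList tm s = ⟨none, tm.initialState, Function.update (fun _ => []) tm.k₁ s⟩ := by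
  unfold haltList
  congr 1
  funext k
  by_cases h : k = tm.k₁
  · subst h; simp
  · simp [h]

theorem exists_runs_of_outputsInTime {tm : FinTM2} {s : List (tm.Γ tm.k₀)}
    {s' : List (tm.Γ tm.k₁)} {n : ℕ} (h : TM2OutputsInTime tm s (some s') n) :
    ∃ k ≤ n, Runs tm.m k
      ⟨some tm.main, tm.initialState, Function.update (fun _ => []) tm.k₀ s⟩
      ⟨none, tm.initialState, Function.update (fun _ => []) tm.k₁ s'⟩ := by
  refine ⟨h.steps, h.steps_le_m, ?_⟩
  rw [runs_iff_iterate, ← initList_eq, ← haltList_eq]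
  exact h.evals_in_steps

theorem PT.sloppy {h : Str → Str} (hh : PT h) : Sloppy h := by
  obtain ⟨C, hC⟩ := hh
  refine ⟨C.tm, hC, C.inputAlphabet, C.outputAlphabet, C.time, fun x => ?_⟩
  obtain ⟨k, hk, hr⟩ := exists_runs_of_outputsInTime (C.outputsFun x)
  exact ⟨k, hk, _, _, hr, by simp⟩

/-- Pop all stacks of a list, and apply `f` to the state if one of them is not empty. -/
def popAll {K Λ σ : Type} {Γ : K → Type} (f : σ → σ) (q : Stmt Γ Λ σ) : List K → Stmt Γ Λ σ
  | [] => q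
  | k :: L => Stmt.pop k (fun s o => cond o.isSome (f s) s) (popAll f q L)

/-- Idempotence of `f` makes it irrelevant how many stacks were nonempty, and `Nodup` ensures that
no stack is popped twice. -/
theorem stepAux_popAll {K Λ σ : Type} [DecidableEq K] {Γ : K → Type} (f : σ → σ)
    (hf : ∀ v, f (f v) = f v) (q : Stmt Γ Λ σ) (L : List K) (hL : L.Nodup) (v : σ)
    (S : ∀ k, List (Γ k)) :
    stepAux (popAll f q L) v S = stepAux q (cond (L.any fun k => (S k).head?.isSome) (f v) v)
      (fun k => if k ∈ L then (S k).tail else S k) := by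
  induction L generalizing v S with
  | nil => simp [popAll]
  | cons k L ih =>
    rw [List.nodup_cons] at hL
    simp only [popAll, stepAux]
    rw [ih hL.2]
    have h1 : (L.any fun k' => (Function.update S k (S k).tail k').head?.isSome) =
        L.any fun k' => (S k').head?.isSome := by
      rw [Bool.eq_iff_iff]
      simp only [List.any_eq_true]
      refine exists_congr fun k' => and_congr_right fun hk' => ?_
      rw [Function.update_of_ne (by rintro rfl; exact hL.1 hk')]
    rw [h1, List.any_cons]
    congr 1
    · cases (S k).head?.isSome <;> cases (L.any fun k' => (S k').head?.isSome) <;> simp [hf]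
    · funext k'
      by_cases hk : k' = k
      · subst hk; simp [hL.1]
      · simp [hk]

section Mix

variable {R P : Type} [DecidableEq R] [DecidableEq P] {Γ : P → Type}

/-- The stacks of a register machine. -/
def mix (S : R → Str) (T : ∀ p, List (Γ p)) : ∀ k, List (Alph R Γ k)
  | Sum.inl r => S r
  | Sum.inr p => T p

theorem mix_nil (S : R → Str) : mix S (fun _ => []) = regs (Γ := Γ) S := by
  funext k; cases k <;> rfl

theorem update_mix_inl (S : R → Str) (T : ∀ p, List (Γ p)) (r : R) (x : Str) :
    Function.update (mix S T) (Sum.inl r) x = mix (Function.update S r x) T := by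
  funext k
  obtain k | p := k
  · by_cases h : k = r
    · subst h; simp [mix]
    · simp [mix, h]
  · simp [mix]

theorem update_mix_inr (S : R → Str) (T : ∀ p, List (Γ p)) (p : P) (x : List (Γ p)) :
    Function.update (mix S T) (Sum.inr p) x = mix S (Function.update T p x) := by
  funext k
  obtain k | k := k
  · simp [mix]
  · by_cases h : k = p
    · subst h; simp [mix]
    · simp [mix, h]

end Mix

/-! ### Calling a machine as a subroutine -/

section Call

variable {R : Type} [DecidableEq R] (tm : FinTM2) (i : tm.Γ tm.k₀ ≃ Bool) (o : tm.Γ tm.k₁ ≃ Bool)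
  (r : R)

/-- The machine `tm` as a part of a register machine. -/
def callEmb : Emb tm.Γ (Alph R tm.Γ) tm.Λ (tm.Λ ⊕ Fin 3) tm.σ (tm.σ × Option Bool) where
  e := Sum.inr
  inj := Sum.inr_injective
  φ _ := Equiv.refl _
  lab := Sum.inl
  ex := some (Sum.inr 1)
  get s := s.1
  set s t := (t, s.2)
  get_set _ _ := rfl
  set_set _ _ _ := rfl

/-- The program that moves the register `r` to the input stack of `tm`, runs `tm`, moves the output
stack to `r` and empties all other stacks of `tm`. -/
noncomputable def callStmt : tm.Λ ⊕ Fin 3 → Stmt (Alph R tm.Γ) (tm.Λ ⊕ Fin 3) (tm.σ × Option Bool)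
  | Sum.inl l => (callEmb tm).tr (tm.m l)
  | Sum.inr 0 =>
    Stmt.pop (Sum.inl r) (fun s x => (s.1, x)) <|
    Stmt.branch (fun s => s.2.isSome)
      (Stmt.push (Sum.inr tm.k₀) (fun s => i.symm (s.2.getD false)) <|
        Stmt.goto fun _ => Sum.inr 0)
      (Stmt.goto fun _ => Sum.inl tm.main)
  | Sum.inr 1 =>
    Stmt.pop (Sum.inr tm.k₁) (fun s x => (s.1, x.map o)) <|
    Stmt.branch (fun s => s.2.isSome)
      (Stmt.push (Sum.inl r) (fun s => s.2.getD false) <| Stmt.goto fun _ => Sum.inr 1)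
      (Stmt.goto fun _ => Sum.inr 2)
  | Sum.inr 2 =>
    Stmt.load (fun s => (s.1, none)) <|
    popAll (fun s => (s.1, some true))
      (Stmt.branch (fun s => s.2.isSome) (Stmt.goto fun _ => Sum.inr 2)
        (Stmt.load (fun _ => (tm.initialState, none)) Stmt.halt))
      (((@Finset.univ _ tm.kFin).toList).map Sum.inr)

/-- Moving symbols one by one reverses them. The scratch bit `b` is arbitrary because it is
overwritten before it is read. -/
theorem runs_callStmt_load (S : R → Str) (v : tm.σ) (x : Str) (w : List (tm.Γ tm.k₀))
    (b : Option Bool) :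
    Runs (callStmt tm i o r) (x.length + 1)
      ⟨some (Sum.inr 0), (v, b),
        mix (Function.update S r x) (Function.update (fun _ => []) tm.k₀ w)⟩
      ⟨some (Sum.inl tm.main), (v, none), mix (Function.update S r [])
        (Function.update (fun _ => []) tm.k₀ (x.reverse.map i.symm ++ w))⟩ := by
  induction x generalizing w b with
  | nil =>
    refine Runs.of_stepAux ?_
    simp only [callStmt, stepAux, update_mix_inl]
    simp [mix]
  | cons a x ih =>
    have := ih (i.symm a :: w) (some a)
    rw [List.length_cons, Nat.add_comm (x.length + 1)]
    refine Runs.trans (Runs.of_stepAux ?_) (by simpa using this)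
    simp only [callStmt, stepAux, update_mix_inl, update_mix_inr]
    simp [mix]

theorem runs_callStmt_unload (S : R → Str) (T : ∀ k, List (tm.Γ k)) (v : tm.σ) (x y : Str)
    (b : Option Bool) :
    Runs (callStmt tm i o r) (x.length + 1)
      ⟨some (Sum.inr 1), (v, b),
        mix (Function.update S r y) (Function.update T tm.k₁ (x.map o.symm))⟩
      ⟨some (Sum.inr 2), (v, none), mix (Function.update S r (x.reverse ++ y))
        (Function.update T tm.k₁ [])⟩ := by
  induction x generalizing y b with
  | nil =>
    refine Runs.of_stepAux ?_
    simp only [callStmt, stepAux, update_mix_inr]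
    simp [mix]
  | cons a x ih =>
    have := ih (a :: y) (some a)
    rw [List.length_cons, Nat.add_comm (x.length + 1)]
    refine Runs.trans (Runs.of_stepAux ?_) (by simpa using this)
    simp only [callStmt, stepAux, update_mix_inl, update_mix_inr]
    simp [mix]

/-- A single step pops all stacks at once, so the time is governed by the longest one, with one more
step to notice that all are empty. -/
theorem runs_callStmt_clean (S : R → Str) (N : ℕ) (T : ∀ k, List (tm.Γ k)) (v : tm.σ)
    (b : Option Bool) (hT : ∀ k, (T k).length ≤ N) :
    ∃ n ≤ N + 1, Runs (callStmt tm i o r) n ⟨some (Sum.inr 2), (v, b), mix S T⟩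
      ⟨none, (tm.initialState, none), regs S⟩ := by
  classical
  have key : ∀ (T : ∀ k, List (tm.Γ k)) (b), stepAux (callStmt tm i o r (Sum.inr 2)) (v, b) (mix S T) =
      if ∀ k, T k = [] then ⟨none, (tm.initialState, none), regs S⟩
      else ⟨some (Sum.inr 2), (v, some true), mix S fun k => (T k).tail⟩ := by
    intro T b
    simp only [callStmt, stepAux]
    rw [stepAux_popAll (fun s => (s.1, some true)) (fun _ => rfl) _ _
      ((Finset.nodup_toList _).map Sum.inr_injective)]
    refine (congrArg (stepAux _ _) (?_ : _ = mix S fun k => (T k).tail)).trans ?_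
    · funext k
      obtain k | k := k
      · simp [mix]
      · simp [mix]
    split_ifs with h
    · have : (((@Finset.univ _ tm.kFin).toList).map Sum.inr).any
          (fun k => (mix S T k).head?.isSome) = false := by
        rw [List.any_eq_false]
        simp [mix, h]
      rw [this]
      simp [h, mix_nil]
    · have : (((@Finset.univ _ tm.kFin).toList).map Sum.inr).any
          (fun k => (mix S T k).head?.isSome) = true := by
        rw [List.any_eq_true]
        push Not at h
        obtain ⟨k, hk⟩ := h
        refine ⟨Sum.inr k, by simp, ?_⟩
        simp only [mix]
        cases hx : T k with
        | nil => exact (hk hx).elim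
        | cons => rfl
      rw [this]
      simp
  induction N generalizing T b with
  | zero =>
    refine ⟨1, le_refl _, Runs.of_stepAux ?_⟩
    rw [key, if_pos fun k => List.length_eq_zero_iff.1 (Nat.le_zero.1 (hT k))]
  | succ N ih =>
    by_cases h : ∀ k, T k = []
    · refine ⟨1, by omega, Runs.of_stepAux ?_⟩
      rw [key, if_pos h]
    · have hT' : ∀ k, (T k).tail.length ≤ N := fun k => by
        rw [List.length_tail]; exact Nat.sub_le_of_le_add (hT k)
      obtain ⟨n, hn, hr⟩ := ih _ (some true) hT'
      refine ⟨1 + n, by omega, Runs.trans (Runs.of_stepAux ?_) hr⟩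
      rw [key, if_neg h]

end Call

variable {α R : Type} [Fintype R] [DecidableEq R] [Inhabited R]

theorem length_le_size (S : R → Str) (r : R) : (S r).length ≤ size S :=
  Finset.single_le_sum (f := fun r => (S r).length) (fun _ _ => Nat.zero_le _)
    (Finset.mem_univ r)

/-- A call of a subroutine, with input and output reversed. -/
theorem Tr.callRaw {h : Str → Str} (hh : Sloppy h) (D : α → Prop) (s : α → R → Str) (r : R) :
    Tr D s fun a => Function.update (s a) r (h (s a r).reverse).reverse := by
  obtain ⟨tm, hfin, i, o, p, hp⟩ := hh
  have := tm.kFin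
  have := tm.ΛFin
  have := tm.σFin
  obtain ⟨C, hC⟩ := exists_length_le_of_runs tm.m
  refine ⟨⟨tm.Γ, tm.Λ ⊕ Fin 3, Sum.inr 0, tm.σ × Option Bool, (tm.initialState, none),
    -- Loading, unloading and cleaning cost at most `|r| + 1`, `|r| + C n + 1` and `|r| + C n + 1`
    -- steps, in addition to the `n ≤ p` steps of the machine itself.
    callStmt tm i o r⟩, X * 3 + p + p * (C : ℕ[X]) * 2 + 3, fun a _ => ?_⟩
  obtain ⟨n, hn, v, T, hr, hT⟩ := hp (s a r).reverse
  have hlen := hC _ _ _ hr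
  simp only at hlen
  have hlen' : ∀ k, (T k).length ≤ (s a r).length + C * n := by
    intro k
    refine (hlen k).trans (Nat.add_le_add_right ?_ _)
    by_cases hk : k = tm.k₀
    · subst hk; simp
    · simp [hk]
  have hsz := length_le_size (s a) r
  have hn' : n ≤ p.eval (size (s a)) := hn.trans (eval_mono p (by simpa using hsz))
  have hCn := Nat.mul_le_mul_left C hn'
  have hy : (h (s a r).reverse).length ≤ (s a r).length + C * n := by
    have := hlen' tm.k₁
    rw [hT] at this
    simpa using this
  have e : (X * 3 + p + p * (C : ℕ[X]) * 2 + 3).eval (size (s a)) =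
      size (s a) * 3 + p.eval (size (s a)) + C * p.eval (size (s a)) * 2 + 3 := by
    simp; ring
  rw [e]
  refine ⟨?_, ?_⟩
  · have := size_update (s a) r (h (s a r).reverse).reverse
    rw [List.length_reverse] at this
    beta_reduce
    omega
  have r1 := runs_callStmt_load tm i o r (s a) tm.initialState (s a r) [] none
  rw [List.append_nil, Function.update_eq_self,
    show Function.update (fun _ => []) tm.k₀ [] = fun _ => [] from Function.update_eq_self _ _,
    mix_nil] at r1
  obtain ⟨⟨l', w', U⟩, r2, h1, h2, h3, h4⟩ := Emb.Rel.runs (E := callEmb (R := R) tm)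
    (m' := callStmt tm i o r) (v₀ := (tm.initialState, none))
    (S₀ := mix (Function.update (s a) r []) fun _ => [])
    (c' := ⟨some (Sum.inl tm.main), (tm.initialState, none),
      mix (Function.update (s a) r []) (Function.update (fun _ => []) tm.k₀
        ((s a r).reverse.map i.symm))⟩) (fun l => rfl)
    ⟨rfl, rfl, fun k => (List.map_id _).symm, by
      rintro (k | k) hk
      · rfl
      · exact (hk ⟨k, rfl⟩).elim⟩ hr
  have hU : U = mix (Function.update (s a) r []) T := by
    funext k
    obtain k | k := k
    · exact h4 _ (by rintro ⟨_, h⟩; cases h)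
    · exact (h3 k).trans (List.map_id _)
  simp only [callEmb, Option.elim] at h1 h2
  subst h1 h2 hU
  have r3 := runs_callStmt_unload tm i o r (s a) T v (h (s a r).reverse) [] none
  rw [← hT, Function.update_eq_self, List.append_nil] at r3
  obtain ⟨n', hn'', r4⟩ := runs_callStmt_clean tm i o r
    (Function.update (s a) r (h (s a r).reverse).reverse) ((s a r).length + C * n)
    (Function.update T tm.k₁ []) v none (by
      intro k
      by_cases hk : k = tm.k₁
      · subst hk; simp
      · simpa [hk] using hlen' k)
  refine ⟨_, ?_, ((r1.trans r2).trans r3).trans r4⟩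
  omega

/-- A transformation of a single register by a register machine. -/
theorem PT.of_tr {h : Str → Str} (r r' : R)
    (hh : Tr (fun _ => True) (fun x : Str => Function.update (fun _ : R => []) r x)
      fun x => Function.update (fun _ => []) r' (h x)) : PT h := by
  obtain ⟨M, p, hp⟩ := hh
  let := Fintype.ofFinite M.P
  let := Fintype.ofFinite M.Λ
  let := Fintype.ofFinite M.σ
  let tm : FinTM2 :=
    { K := R ⊕ M.P, k₀ := Sum.inl r, k₁ := Sum.inl r', Γ := Alph R M.Γ, Λ := M.Λ, main := M.main,
      σ := M.σ, initialState := M.ini, m := M.m, Γk₀Fin := inferInstanceAs (Fintype Bool) }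
  have hreg : ∀ (r : R) (x : Str), regs (Γ := M.Γ) (Function.update (fun _ => []) r x) =
      (Function.update (fun _ => []) (Sum.inl r) x : ∀ k, List (Alph R M.Γ k)) := by
    intro r x
    rw [Tr.regs_update]
    congr 1
    funext k
    cases k <;> rfl
  have hex : ∀ x, ∃ n ≤ p.eval x.length, Runs tm.m n
      (initList tm (x.map (Equiv.refl Bool).symm)) (haltList tm ((h x).map (Equiv.refl Bool).symm)) := by
    intro x
    obtain ⟨-, n, hn, hr⟩ := hp x trivial
    refine ⟨n, ?_, ?_⟩
    · have := Tr.size_update (fun _ : R => []) r x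
      simp [size] at this
      rwa [size, this] at hn
    · rw [initList_eq, haltList_eq, List.map_id'', List.map_id'']
      · simp only [RM.Computes, hreg] at hr
        exact hr
      · exact fun _ => rfl
      · exact fun _ => rfl
  choose n hn hr using hex
  refine ⟨⟨⟨tm, Equiv.refl Bool, Equiv.refl Bool⟩, p, fun x => ⟨⟨n x, runs_iff_iterate.1 (hr x)⟩,
    hn x⟩⟩, ?_⟩
  rintro (k | k)
  · exact inferInstanceAs (Finite Bool)
  · exact inferInstanceAs (Finite (M.Γ k))

/-! ### Basic programs -/

section Programs

variable {α R : Type} [Fintype R] [DecidableEq R] [Inhabited R]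

namespace Tr

theorem casesBool {D : α → Prop} {s t : α → R → Str} (r : R)
    (hn : Tr (fun a => D a ∧ s a r = []) s t)
    (h : ∀ b, Tr (fun a => D a ∧ (s a r).head? = some b) s t) : Tr D s t := by
  refine cases r fun o => ?_
  cases o with
  | none => exact hn.mono fun a ha => ⟨ha.1, List.head?_eq_none_iff.1 ha.2⟩
  | some b => exact h b

/-- Move a register to another one, reversed. -/
theorem moveRev (D : α → Prop) (s : α → R → Str) {r q : R} (h : r ≠ q) :
    Tr D s fun a => Function.update (Function.update (s a) q ((s a r).reverse ++ s a q)) r [] := by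
  -- The default `false` never matters, because the loop body runs only if the register `r` is
  -- nonempty.
  let next : (R → Str) → R → Str := fun S =>
    Function.update (Function.update S q ((S r).head?.getD false :: S q)) r (S r).tail
  let fin : (R → Str) → R → Str := fun S =>
    Function.update (Function.update S q ((S r).reverse ++ S q)) r []
  have hsize : ∀ S : R → Str, S r ≠ [] → size (next S) = size S := by
    intro S hS
    have h1 := size_update (Function.update S q ((S r).head?.getD false :: S q)) r (S r).tail
    have h2 := size_update S q ((S r).head?.getD false :: S q)
    have h3 := List.length_pos_of_ne_nil hS
    rw [Function.update_of_ne h, List.length_tail] at h1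
    rw [List.length_cons] at h2
    simp only [next]
    omega
  have main : Tr (fun _ => True) (fun S : R → Str => S) fin := by
    -- The register contents serve as their own parameter; the general case follows by `comap s`.
    refine loop r (s := fun S : R → Str => S) next fin (casesBool r ?_ fun b => ?_) ?_ ?_ ?_ size
      (fun _ => le_rfl) (fun S hS => (hsize S hS).le) X (fun S => by simp)
    · exact (refl _ _).congr (fun _ h => h) (fun _ _ => rfl) fun a ha => absurd ha.2 ha.1
    · refine ((push _ _ q b).trans (pop _ _ r)).to_eq fun S hS => ?_
      simp [next, hS.2, Function.update_of_ne h]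
    · intro S hS
      simp only [fin]
      rw [hS, List.reverse_nil, List.nil_append, Function.update_eq_self, ← hS,
        Function.update_eq_self]
    · intro S hS
      obtain ⟨b, l, hl⟩ := List.exists_cons_of_ne_nil hS
      funext k
      by_cases hk : k = r
      · subst hk; simp [fin]
      · by_cases hk' : k = q
        · subst hk'
          simp [fin, next, hl, Function.update_of_ne h.symm]
        · simp [fin, next, hk, hk']
    · intro S hS
      simp [next, List.length_pos_of_ne_nil hS]
  exact (main.comap s).mono fun _ _ => trivial

/-- Move a register to two other ones, reversed. -/
theorem moveRev₂ (D : α → Prop) (s : α → R → Str) {r q q' : R} (h : r ≠ q) (h' : r ≠ q')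
    (hq : q ≠ q') : Tr D s fun a => Function.update (Function.update
      (Function.update (s a) q ((s a r).reverse ++ s a q)) q' ((s a r).reverse ++ s a q')) r [] := by
  let next : (R → Str) → R → Str := fun S =>
    Function.update (Function.update (Function.update S q ((S r).head?.getD false :: S q)) q'
      ((S r).head?.getD false :: S q')) r (S r).tail
  let fin : (R → Str) → R → Str := fun S =>
    Function.update (Function.update (Function.update S q ((S r).reverse ++ S q)) q'
      ((S r).reverse ++ S q')) r []
  have hsize : ∀ S : R → Str, S r ≠ [] → size (next S) = size S + 1 := by
    intro S hS
    have h1 := size_update (Function.update (Function.update S q ((S r).head?.getD false :: S q)) q'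
      ((S r).head?.getD false :: S q')) r (S r).tail
    have h2 := size_update (Function.update S q ((S r).head?.getD false :: S q)) q'
      ((S r).head?.getD false :: S q')
    have h2' := size_update S q ((S r).head?.getD false :: S q)
    have h3 := List.length_pos_of_ne_nil hS
    rw [Function.update_of_ne h', Function.update_of_ne h, List.length_tail] at h1
    rw [List.length_cons, Function.update_of_ne hq.symm] at h2
    rw [List.length_cons] at h2'
    simp only [next]
    omega
  have main : Tr (fun _ => True) (fun S : R → Str => S) fin := by
    refine loop r (s := fun S : R → Str => S) next fin (casesBool r ?_ fun b => ?_) ?_ ?_ ?_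
      -- The total size grows by one in each round while `r` shrinks by one, so this sum is
      -- constant.
      (fun S => size S + (S r).length)
      (fun _ => Nat.le_add_right _ _) (fun S hS => ?_) (X * 2) (fun S => ?_)
    · exact (refl _ _).congr (fun _ h => h) (fun _ _ => rfl) fun a ha => absurd ha.2 ha.1
    · refine (((push _ _ q b).trans (push _ _ q' b)).trans (pop _ _ r)).to_eq fun S hS => ?_
      simp [next, hS.2, Function.update_of_ne h, Function.update_of_ne h',
        Function.update_of_ne hq.symm]
    · intro S hS
      simp only [fin]
      funext k
      by_cases hk : k = r
      · subst hk; simp [hS]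
      · by_cases hk' : k = q'
        · subst hk'; simp [hS, hk]
        · by_cases hk'' : k = q
          · subst hk''; simp [hS, hk]
          · simp [hk, hk', hk'']
    · intro S hS
      obtain ⟨b, l, hl⟩ := List.exists_cons_of_ne_nil hS
      funext k
      by_cases hk : k = r
      · subst hk; simp [fin]
      · by_cases hk' : k = q'
        · subst hk'
          simp [fin, next, hl, hk]
        · by_cases hk'' : k = q
          · subst hk''
            simp [fin, next, hl, hk, hk']
          · simp [fin, next, hk, hk', hk'']
    · intro S hS
      simp [next, List.length_pos_of_ne_nil hS]
    · have := hsize S hS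
      have h3 := List.length_pos_of_ne_nil hS
      have h4 : (next S r).length = (S r).length - 1 := by simp [next]
      omega
    · have := length_le_size S r
      simp
      omega
  exact (main.comap s).mono fun _ _ => trivial

theorem clear (D : α → Prop) (s : α → R → Str) (r : R) :
    Tr D s fun a => Function.update (s a) r [] := by
  have main : Tr (fun _ => True) (fun S : R → Str => S) (fun S => Function.update S r []) := by
    refine loop r (s := fun S : R → Str => S) (fun S => Function.update S r (S r).tail)
      (fun S => Function.update S r []) (pop _ _ r) ?_ ?_ ?_ size (fun _ => le_rfl)
      (fun S _ => ?_) X (fun S => by simp)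
    · intro S hS
      rw [← hS, Function.update_eq_self]
    · simp
    · intro S hS
      simp [List.length_pos_of_ne_nil hS]
    · have h1 := size_update S r (S r).tail
      rw [List.length_tail] at h1
      omega
  exact (main.comap s).mono fun _ _ => trivial

/-- Put a copy of `r` on top of `q`, using the empty register `t`. -/
theorem copy (D : α → Prop) (s : α → R → Str) {r q t : R} (h : r ≠ q) (ht : t ≠ r) (ht' : t ≠ q)
    (hs : ∀ a, D a → s a t = []) :
    Tr D s fun a => Function.update (s a) q (s a r ++ s a q) := by
  -- The detour through `t` reverses twice, so both copies have the original order.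
  refine ((moveRev D s ht.symm).trans (moveRev₂ _ _ ht ht' h)).to_eq fun a ha => ?_
  have := hs a ha
  funext k
  by_cases hk : k = t
  · subst hk; simp [this, ht']
  · by_cases hk' : k = q
    · subst hk'
      simp [hk, this, ht, h.symm]
    · by_cases hk'' : k = r
      · subst hk''
        simp [this, h, ht, ht.symm]
      · simp [hk, hk', hk'']

/-- Call of a subroutine, using the empty register `t`. -/
theorem call {h : Str → Str} (hh : Sloppy h) (D : α → Prop) (s : α → R → Str) {r t : R}
    (hr : r ≠ t) (hs : ∀ a, D a → s a t = []) :
    Tr D s fun a => Function.update (s a) r (h (s a r)) := by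
  -- The two moves undo the reversals of input and output in `callRaw`.
  refine (((moveRev D s hr).trans (callRaw hh _ _ t)).trans (moveRev _ _ hr.symm)).to_eq
    fun a ha => ?_
  have := hs a ha
  funext k
  by_cases hk : k = t
  · subst hk; simp [this, hr.symm]
  · by_cases hk' : k = r
    · subst hk'
      simp [hr, hr.symm, this]
    · simp [hk, hk']

/-- Set a register. -/
theorem setBit (D : α → Prop) (s : α → R → Str) (r : R) (b : Bool) :
    Tr D s fun a => Function.update (s a) r [b] :=
  ((clear D s r).trans (push _ _ r b)).to_eq fun a _ => by simp

/-- The result of a comparison of two strings: what remains of the second one, and the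
differences found. -/
def cmp : Str → Str → Str → Str × Str
  | [], B, E => (B, E)
  | x :: A, B, E => if B.head? = some x then cmp A B.tail E else cmp A B (true :: E)

/-- A mismatch, including an exhausted second string, leaves a mark in the second component, and a
surplus of the second string survives in the first. Equality leaves neither. -/
theorem cmp_eq_nil (A B E : Str) : cmp A B E = ([], []) ↔ A = B ∧ E = [] := by
  induction A generalizing B E with
  | nil => simp [cmp, eq_comm]
  | cons x A ih =>
    cases B with
    | nil => simp [cmp, ih]
    | cons y B =>
      simp only [cmp, List.head?_cons, Option.some.injEq, List.tail_cons]
      split_ifs with h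
      · simp [ih, h]
      · simp [ih, Ne.symm h]

/-- Compare the registers `a` and `b`, empty them and put the result into the empty
register `e`. -/
theorem eqTest (D : α → Prop) (s : α → R → Str) {a b e : R} (hab : a ≠ b) (hae : a ≠ e)
    (hbe : b ≠ e) (hs : ∀ x, D x → s x e = []) :
    Tr D s fun x => Function.update (Function.update (Function.update (s x) a []) b []) e
      [decide (s x a = s x b)] := by
  have hba := hab.symm
  have hea := hae.symm
  have heb := hbe.symm
  let next : (R → Str) → R → Str := fun S =>
    if (S b).head? = (S a).head? then
      Function.update (Function.update S a (S a).tail) b (S b).tail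
    else Function.update (Function.update S a (S a).tail) e (true :: S e)
  let fin : (R → Str) → R → Str := fun S => Function.update (Function.update
    (Function.update S a []) b (cmp (S a) (S b) (S e)).1) e (cmp (S a) (S b) (S e)).2
  have main : Tr (fun _ => True) (fun S : R → Str => S) fin := by
    refine loop a (s := fun S : R → Str => S) next fin (casesBool a ?_ fun x => cases b fun y => ?_)
      ?_ ?_ ?_ size (fun _ => le_rfl) (fun S hS => ?_) X (fun S => by simp)
    · exact (refl _ _).congr (fun _ h => h) (fun _ _ => rfl) fun a ha => absurd ha.2 ha.1
    · by_cases hxy : y = some x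
      · refine ((pop _ _ a).trans (pop _ _ b)).to_eq fun S hS => ?_
        simp [next, hS.1.2, hS.2, hxy, hab.symm]
      · refine ((pop _ _ a).trans (push _ _ e true)).to_eq fun S hS => ?_
        simp [next, hS.1.2, hS.2, hxy, hae.symm]
    · intro S hS
      simp only [fin, hS, cmp]
      rw [← hS, Function.update_eq_self, Function.update_eq_self, Function.update_eq_self]
    · intro S hS
      obtain ⟨x, l, hl⟩ := List.exists_cons_of_ne_nil hS
      simp only [next, hl]
      funext k
      split_ifs with h
      · simp only [fin]
        by_cases hke : k = e
        · subst hke; simp_all [cmp]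
        · by_cases hkb : k = b
          · subst hkb; simp_all [cmp]
          · by_cases hka : k = a
            · subst hka; simp [hab, hae]
            · simp [hke, hkb, hka]
      · simp only [fin]
        by_cases hke : k = e
        · subst hke; simp_all [cmp]
        · by_cases hkb : k = b
          · subst hkb; simp_all [cmp]
          · by_cases hka : k = a
            · subst hka; simp [hab, hae]
            · simp [hke, hkb, hka]
    · intro S hS
      have := List.length_pos_of_ne_nil hS
      simp only [next]
      split_ifs <;> simp [hab, hae, this]
    · have h0 := List.length_pos_of_ne_nil hS
      have h1 := size_update S a (S a).tail
      rw [List.length_tail] at h1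
      simp only [next]
      split_ifs
      · have h2 := size_update (Function.update S a (S a).tail) b (S b).tail
        rw [Function.update_of_ne hab.symm, List.length_tail] at h2
        omega
      · have h2 := size_update (Function.update S a (S a).tail) e (true :: S e)
        rw [Function.update_of_ne hae.symm, List.length_cons] at h2
        omega
  refine ((main.comap s).mono fun _ _ => trivial).trans ?_
  have hcmp : ∀ x, D x → (cmp (s x a) (s x b) (s x e) = ([], []) ↔ s x a = s x b) := by
    intro x hx
    rw [cmp_eq_nil]
    simp [hs x hx]
  -- The two signs of inequality, a remainder in `b` and a mark in `e`, call for the same clean-up.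
  have hfalse : Tr (fun x => D x ∧ s x a ≠ s x b) (fun x => fin (s x)) fun x => Function.update
      (Function.update (Function.update (s x) a []) b []) e [decide (s x a = s x b)] := by
    refine ((clear _ _ b).trans (setBit _ _ e false)).to_eq fun x hx => ?_
    funext k
    by_cases hke : k = e
    · subst hke; simp [hx.2]
    · by_cases hkb : k = b
      · subst hkb; simp [hbe]
      · simp [hke, hkb, fin]
  have hb : ∀ x, fin (s x) b = (cmp (s x a) (s x b) (s x e)).1 := fun x => by simp [fin, hbe]
  have he : ∀ x, fin (s x) e = (cmp (s x a) (s x b) (s x e)).2 := fun x => by simp [fin]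
  refine casesBool b (casesBool e ?_ fun y => ?_) fun y => ?_
  · refine (push _ _ e true).to_eq fun x hx => ?_
    have h1 : cmp (s x a) (s x b) (s x e) = ([], []) :=
      Prod.ext ((hb x).symm.trans hx.1.2) ((he x).symm.trans hx.2)
    have h2 := (hcmp x hx.1.1).1 h1
    simp only [fin, h1]
    simp [h2]
  · refine hfalse.mono fun x hx => ⟨hx.1.1, fun h => ?_⟩
    have := hx.2
    rw [he, (hcmp x hx.1.1).2 h] at this
    cases this
  · refine hfalse.mono fun x hx => ⟨hx.1, fun h => ?_⟩
    have := hx.2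
    rw [hb, (hcmp x hx.1).2 h] at this
    cases this

end Tr

end Programs

/-! ### Programs with eight registers -/

/-- The contents of eight registers. -/
def st (a b c d e f g h : Str) : Fin 8 → Str := ![a, b, c, d, e, f, g, h]

section st

variable (a b c d e f g h x : Str)

@[simp] theorem st_apply_0 : st a b c d e f g h 0 = a := rfl

@[simp] theorem st_apply_1 : st a b c d e f g h 1 = b := rfl

@[simp] theorem st_apply_2 : st a b c d e f g h 2 = c := rfl

@[simp] theorem st_apply_3 : st a b c d e f g h 3 = d := rfl

@[simp] theorem st_apply_4 : st a b c d e f g h 4 = e := rfl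

@[simp] theorem st_apply_5 : st a b c d e f g h 5 = f := rfl

@[simp] theorem st_apply_6 : st a b c d e f g h 6 = g := rfl

@[simp] theorem st_apply_7 : st a b c d e f g h 7 = h := rfl

@[simp] theorem update_st_0 :
    Function.update (st a b c d e f g h) 0 x = st x b c d e f g h := by
  funext k; fin_cases k <;> rfl

@[simp] theorem update_st_1 :
    Function.update (st a b c d e f g h) 1 x = st a x c d e f g h := by
  funext k; fin_cases k <;> rfl

@[simp] theorem update_st_2 :
    Function.update (st a b c d e f g h) 2 x = st a b x d e f g h := by
  funext k; fin_cases k <;> rfl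

@[simp] theorem update_st_3 :
    Function.update (st a b c d e f g h) 3 x = st a b c x e f g h := by
  funext k; fin_cases k <;> rfl

@[simp] theorem update_st_4 :
    Function.update (st a b c d e f g h) 4 x = st a b c d x f g h := by
  funext k; fin_cases k <;> rfl

@[simp] theorem update_st_5 :
    Function.update (st a b c d e f g h) 5 x = st a b c d e x g h := by
  funext k; fin_cases k <;> rfl

@[simp] theorem update_st_6 :
    Function.update (st a b c d e f g h) 6 x = st a b c d e f x h := by
  funext k; fin_cases k <;> rfl

@[simp] theorem update_st_7 :
    Function.update (st a b c d e f g h) 7 x = st a b c d e f g x := by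
  funext k; fin_cases k <;> rfl

theorem size_st : size (st a b c d e f g h) = a.length + b.length + c.length + d.length +
    e.length + f.length + g.length + h.length := by
  simp [size, st, Fin.sum_univ_succ]
  omega

end st

/-! ### Closure properties of polynomial-time functions -/

theorem PT.of_tr_st {h : Str → Str}
    (hh : Tr (fun _ => True) (fun x : Str => st x [] [] [] [] [] [] [])
      fun x => st (h x) [] [] [] [] [] [] []) : PT h := by
  have e : ∀ x, st x [] [] [] [] [] [] [] = Function.update (fun _ => []) 0 x := by
    intro x; funext k; fin_cases k <;> rfl
  exact PT.of_tr 0 0 (hh.congr (fun _ h => h) (fun x _ => e x) fun x _ => e (h x))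

theorem PT.comp {h k : Str → Str} (hh : PT h) (hk : PT k) : PT fun x => h (k x) :=
  PT.of_tr_st <| ((Tr.call hk.sloppy _ _ (r := 0) (t := 1) (by decide) (by simp)).trans
    (Tr.call hh.sloppy _ _ (r := 0) (t := 1) (by decide) (by simp))).to_eq (by simp)

theorem PT.cons (b : Bool) : PT fun x => b :: x :=
  PT.of_tr_st <| (Tr.push _ _ 0 b).to_eq (by simp)

/-- This is the step from one partial function to the next in a composition: the first symbol is the
verdict of the inner function, and `h` runs only if it is positive. -/
theorem PT.ite_head {h : Str → Str} (hh : PT h) :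
    PT fun x => if x.head? = some true then h x.tail else [false] := by
  refine PT.of_tr_st (Tr.casesBool 0 ?_ fun b => ?_)
  · refine (Tr.setBit _ _ 0 false).to_eq fun x hx => ?_
    simp at hx
    simp [hx]
  · cases b
    · refine (Tr.setBit _ _ 0 false).to_eq fun x hx => ?_
      simp at hx
      simp [hx]
    · refine ((Tr.pop _ _ 0).trans (Tr.call hh.sloppy _ _ (r := 0) (t := 1) (by decide)
        (by simp))).to_eq fun x hx => ?_
      simp at hx
      simp [hx]

theorem PT.head : PT fun x => [decide (x.head? = some true)] := by
  refine PT.of_tr_st (Tr.casesBool 0 ?_ fun b => ?_)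
  · refine (Tr.setBit _ _ 0 false).to_eq fun x hx => ?_
    simp at hx
    simp [hx]
  · refine (Tr.setBit _ _ 0 b).to_eq fun x hx => ?_
    simp at hx
    simp [hx]

/-- The inverter that checks the answers of `g`. -/
def checked (f g : Str → Option Str) (y : Str) : Option Str :=
  (g y).bind fun x => if f x = some y then some x else none

theorem encodeResult_ne_nil (o : Option Str) : encodeResult o ≠ [] := by
  cases o <;> simp [encodeResult]

theorem head_encodeResult (o : Option Str) (b : Bool) :
    (encodeResult o).head? = some b ↔ o.isSome = b := by
  cases o <;> simp [encodeResult]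

/-- A register holding a string `x` of which the image under `f` is compared to another
register. -/
theorem Tr.checkImage {α : Type} {f : Str → Option Str} (hf : PT fun x => encodeResult (f x))
    (D : α → Prop) (y x z : α → Str) :
    Tr D (fun a => st (y a) (x a) [] [] [] [] [] (z a))
      fun a => st [decide (f (x a) = some (y a))] [] [] [] [] [] [] (z a) := by
  refine (Tr.call hf.sloppy _ _ (r := 1) (t := 2) (by decide) (by simp)).trans
    (Tr.casesBool 1 ?_ fun b => ?_)
  · exact (Tr.refl _ _).congr (fun _ h => h) (fun _ _ => rfl) fun a ha => by
      simp [encodeResult_ne_nil] at ha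
  · cases b
    · refine ((Tr.clear _ _ 1).trans (Tr.setBit _ _ 0 false)).to_eq fun a ha => ?_
      simp [head_encodeResult] at ha
      simp [ha]
    · refine (((Tr.pop _ _ 1).trans (Tr.eqTest _ _ (a := 0) (b := 1) (e := 2) (by decide)
        (by decide) (by decide) (by simp))).trans (Tr.moveRev _ _ (r := 2) (q := 0)
        (by decide))).to_eq fun a ha => ?_
      simp only [update_st_1, st_apply_1, head_encodeResult, Option.isSome_iff_exists] at ha
      obtain ⟨-, w, hw⟩ := ha
      simp [hw, encodeResult, eq_comm]

/-- The answer of `g` is saved in register 7 while its image under `f` is compared with `y`; the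
comparison consumes both the answer and `y`. -/
theorem PT.checked {f g : Str → Option Str} (hf : PT fun x => encodeResult (f x))
    (hg : PT fun x => encodeResult (g x)) : PT fun y => encodeResult (checked f g y) := by
  refine PT.of_tr_st ?_
  refine (Tr.copy _ _ (r := 0) (q := 1) (t := 2) (by decide) (by decide) (by decide)
    (by simp)).trans ((Tr.call hg.sloppy _ _ (r := 1) (t := 2) (by decide) (by simp)).trans
    (Tr.casesBool 1 ?_ fun b => ?_))
  -- Vacuous, since every encoded result begins with a verdict bit.
  · exact (Tr.refl _ _).congr (fun _ h => h) (fun _ _ => rfl) fun a ha => by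
      simp [encodeResult_ne_nil] at ha
  · cases b
    · refine ((Tr.clear _ _ 1).trans (Tr.setBit _ _ 0 false)).to_eq fun y hy => ?_
      simp [head_encodeResult] at hy
      simp [PolyFun.checked, hy, encodeResult]
    · refine (Tr.pop _ _ 1).trans ((Tr.copy _ _ (r := 1) (q := 7) (t := 2) (by decide)
        (by decide) (by decide) (by simp)).trans ?_)
      simp only [update_st_1, st_apply_1, update_st_7, st_apply_7, st_apply_0, List.append_nil]
      refine (Tr.checkImage hf _ _ _ _).trans (Tr.casesBool 0 ?_ fun b => ?_)
      · exact (Tr.refl _ _).congr (fun _ h => h) (fun _ _ => rfl) fun a ha => by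
          simp at ha
      · cases b
        · refine (Tr.clear _ _ 7).to_eq fun y hy => ?_
          simp only [st_apply_0, head_encodeResult, Option.isSome_iff_exists] at hy
          obtain ⟨⟨-, x, hx⟩, h⟩ := hy
          simp [hx, encodeResult] at h
          simp [hx, h, PolyFun.checked, encodeResult]
        · refine (((Tr.clear _ _ 0).trans (Tr.moveRev _ _ (r := 7) (q := 1) (by decide))).trans
            (Tr.moveRev _ _ (r := 1) (q := 0) (by decide))).trans (Tr.push _ _ 0 true)|>.to_eq
            fun y hy => ?_
          simp only [st_apply_0, head_encodeResult, Option.isSome_iff_exists] at hy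
          obtain ⟨⟨-, x, hx⟩, h⟩ := hy
          simp [hx, encodeResult] at h
          simp [hx, h, PolyFun.checked, encodeResult]

/-! ### The monoid `fP` -/

/-- A computation of `g` with output encoder `enc` involves only the composite `enc (g x)`, so the
same machine serves on both sides. -/
theorem detPolyTime_iff {β : Type} (enc : β → Str) (g : Str → β) :
    DetPolyTime enc g ↔ PT fun x => enc (g x) :=
  ⟨fun ⟨C, hC⟩ => ⟨⟨C.toTM2ComputableAux, C.time, C.outputsFun⟩, hC⟩,
    fun ⟨C, hC⟩ => ⟨⟨C.toTM2ComputableAux, C.time, C.outputsFun⟩, hC⟩⟩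

theorem mem_fP_iff (f : Str →. Str) : f ∈ fP ↔ PolyBalanced f ∧
    ∃ g : Str → Option Str, (∀ x, f x = (g x : Part Str)) ∧ PT fun x => encodeResult (g x) := by
  simp only [fP, PolyTimeComputable, detPolyTime_iff, Set.mem_ofPred_eq]

theorem one_mem_fP : (1 : Str →. Str) ∈ fP := by
  rw [mem_fP_iff]
  refine ⟨⟨X, X, fun x y hy => ?_⟩, some, fun x => rfl, PT.cons true⟩
  have : y = x := Part.mem_some_iff.1 hy
  simp [this]

theorem PT.bind {f g : Str → Option Str} (hf : PT fun x => encodeResult (f x))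
    (hg : PT fun x => encodeResult (g x)) : PT fun x => encodeResult ((g x).bind f) := by
  convert (PT.ite_head hf).comp hg using 2 with x
  cases g x <;> simp [encodeResult]

theorem mul_mem_fP {f g : Str →. Str} (hf : f ∈ fP) (hg : g ∈ fP) : f * g ∈ fP := by
  rw [mem_fP_iff] at hf hg ⊢
  obtain ⟨⟨p, q, hf⟩, f', hf', hf''⟩ := hf
  obtain ⟨⟨p', q', hg⟩, g', hg', hg''⟩ := hg
  refine ⟨⟨p.comp p', q'.comp q, fun x z hz => ?_⟩, fun x => (g' x).bind f', fun x => ?_,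
    hf''.bind hg''⟩
  · obtain ⟨y, hy, hz⟩ := Part.mem_bind_iff.1 (show z ∈ (g x).bind f from hz)
    rw [eval_comp, eval_comp]
    exact ⟨(hf y z hz).1.trans (eval_mono p (hg x y hy).1),
      (hg x y hy).2.trans (eval_mono q' (hf y z hz).2)⟩
  · change (g x).bind f = ((g' x).bind f' : Option Str)
    rw [hg' x]
    cases g' x with
    | none => exact Part.bind_none f
    | some y => exact (Part.bind_some y f).trans (hf' y)

/-- The submonoid of polynomially balanced, polynomial-time computable partial functions. -/
def fPSubmonoid : Submonoid (Str →. Str) where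
  carrier := fP
  one_mem' := one_mem_fP
  mul_mem' := mul_mem_fP

/-! ### Regular elements and one-way functions -/

/-- The answers of `g` are verified. This turns an inverter that is unconstrained off the image into
a balanced partial function with domain exactly the image. The total version `k` is exposed because
its verdict bit will decide the image. -/
theorem exists_inverse {f : Str →. Str} (hf : f ∈ fP) {g : Str →. Str}
    (hg : PolyTimeComputable g) (hfg : ∀ y ∈ f.ran, ∃ x ∈ g y, y ∈ f x) :
    ∃ g' ∈ fP, ∃ k : Str → Option Str, (∀ x, g' x = (k x : Part Str)) ∧
      (PT fun x => encodeResult (k x)) ∧ (∀ y x, x ∈ g' y → y ∈ f x) ∧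
      ∀ y, (k y).isSome ↔ y ∈ f.ran := by
  obtain ⟨g₀, hg₀, hg₁⟩ := hg
  rw [detPolyTime_iff] at hg₁
  obtain ⟨⟨p, q, hb⟩, f₀, hf₀, hf₁⟩ := (mem_fP_iff f).1 hf
  have h1 : ∀ y x, x ∈ checked f₀ g₀ y → y ∈ f x := by
    intro y x hx
    simp only [checked, Option.mem_def, Option.bind_eq_some_iff] at hx
    obtain ⟨z, -, hz⟩ := hx
    split_ifs at hz with h
    cases hz
    rw [hf₀, h]
    simp
  have h2 : ∀ y x, x ∈ (fun y => (checked f₀ g₀ y : Part Str) : Str →. Str) y → y ∈ f x := by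
    intro y x hx
    exact h1 y x (by simpa using hx)
  refine ⟨fun y => (checked f₀ g₀ y : Part Str), (mem_fP_iff _).2 ⟨⟨q, p, fun y x hx => ?_⟩,
    _, fun _ => rfl, hf₁.checked hg₁⟩, _, fun _ => rfl, hf₁.checked hg₁, h2, fun y => ?_⟩
  · exact (hb x y (h2 y x hx)).symm
  · refine ⟨fun h => ?_, fun h => ?_⟩
    · obtain ⟨x, hx⟩ := Option.isSome_iff_exists.1 h
      exact ⟨x, h1 y x hx⟩
    · obtain ⟨x, hx, hy⟩ := hfg y h
      rw [hg₀] at hx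
      rw [hf₀] at hy
      simp only [Part.mem_coe, Option.mem_def] at hx hy
      simp [checked, hx, hy]

/-- `f * g * f = f` forces `g` to choose preimages on the image of `f`. Conversely, `f` composed
with the checked inverse is the identity on that image. -/
theorem isRegularElement_iff {f : Str →. Str} (hf : f ∈ fP) :
    IsRegularElement (⟨f, hf⟩ : fPSubmonoid) ↔ ¬ IsOneWay f := by
  constructor
  · rintro ⟨⟨g, hg⟩, h⟩ ⟨-, h'⟩
    refine h' ⟨g, hg.2, fun y hy => ?_⟩
    obtain ⟨x, hx⟩ := hy
    have h1 : f * g * f = f := congrArg Subtype.val h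
    have h2 : y ∈ (f * g * f) x := by rw [h1]; exact hx
    obtain ⟨y', hy', h3⟩ := Part.mem_bind_iff.1 (show y ∈ (f x).bind (f * g) from h2)
    cases Part.mem_unique hx hy'
    exact Part.mem_bind_iff.1 (show y ∈ (g y).bind f from h3)
  · intro h
    have : ∃ g : Str →. Str, PolyTimeComputable g ∧ ∀ y ∈ f.ran, ∃ x ∈ g y, y ∈ f x := by
      by_contra h'
      exact h ⟨hf, h'⟩
    obtain ⟨g, hg, hfg⟩ := this
    obtain ⟨g', hg', k, hk, -, h1, h2⟩ := exists_inverse hf hg hfg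
    refine ⟨⟨g', hg'⟩, Subtype.ext ?_⟩
    change f * g' * f = f
    funext x
    change (f x).bind (fun y => (g' y).bind f) = f x
    refine Part.ext fun y => ?_
    rw [Part.mem_bind_iff]
    constructor
    · rintro ⟨y', hy', h⟩
      obtain ⟨x', hx', h⟩ := Part.mem_bind_iff.1 h
      cases Part.mem_unique h (h1 y' x' hx')
      exact hy'
    · intro hy
      refine ⟨y, hy, Part.mem_bind_iff.2 ?_⟩
      obtain ⟨x', hx'⟩ := Option.isSome_iff_exists.1 ((h2 y).2 ⟨x, hy⟩)
      have : x' ∈ g' y := by rw [hk, hx']; simp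
      exact ⟨x', this, h1 y x' this⟩

theorem isRegularSemigroup_iff :
    IsRegularSemigroup fPSubmonoid ↔ ¬ ∃ f : Str →. Str, IsOneWay f := by
  constructor
  · rintro h ⟨f, hf⟩
    exact (isRegularElement_iff hf.1).1 (h ⟨f, hf.1⟩) hf
  · rintro h ⟨f, hf⟩
    exact (isRegularElement_iff hf).2 fun h' => h ⟨f, h'⟩

/-! ### Guess and verify -/

/-- The first string and the second one, interleaved and reversed, on top of the third one. -/
def weave : Str → Str → Str → Str
  | b :: u, c :: v, w => weave u v (b :: c :: w)
  | _, _, w => w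

theorem length_weave (u c w : Str) (h : c.length = u.length) :
    (weave u c w).length = 2 * u.length + w.length := by
  induction u generalizing c w with
  | nil => simp [weave]
  | cons b u ih =>
    cases c with
    | nil => simp at h
    | cons a c =>
      rw [weave, ih _ _ (by simpa using h)]
      simp
      ring

section Guess

/-- The stack alphabets of a machine with an additional binary stack. -/
@[reducible] def OptAlph {K : Type} (Γ : K → Type) : Option K → Type
  | none => Bool
  | some k => Γ k

variable (tm : FinTM2) (i : tm.Γ tm.k₀ ≃ Bool)

/-- The machine `tm` as a part of a machine with an additional input stack. -/
def guessEmb : Emb tm.Γ (OptAlph tm.Γ) tm.Λ (Option tm.Λ) tm.σ (tm.σ × Option Bool) where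
  e := some
  inj := Option.some_injective _
  φ _ := Equiv.refl _
  lab := some
  ex := none
  get s := s.1
  set s t := (t, s.2)
  get_set _ _ := rfl
  set_set _ _ _ := rfl

/-- Move a symbol to the input stack of `tm`, after the guess `c`, or start `tm` if there is no
symbol left. -/
def guessStmt (c : Bool) : Stmt (OptAlph tm.Γ) (Option tm.Λ) (tm.σ × Option Bool) :=
  Stmt.pop none (fun s x => (s.1, x)) <|
  Stmt.branch (fun s => s.2.isSome)
    (Stmt.push (some tm.k₀) (fun _ => i.symm c) <|
      Stmt.push (some tm.k₀) (fun s => i.symm (s.2.getD false)) <| Stmt.goto fun _ => none)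
    (Stmt.goto fun _ => some tm.main)

/-- The machine that guesses a string of the same length as the input, and runs `tm` on both. -/
noncomputable def guessNTM [∀ k, Finite (tm.Γ k)] (o : tm.Γ tm.k₁ ≃ Bool) : NTM :=
  letI := tm.kFin
  letI := tm.ΛFin
  letI := tm.σFin
  { K := Option tm.K
    k₀ := none
    k₁ := some tm.k₁
    Γ := OptAlph tm.Γ
    finΓ := fun k => match k with
      | none => inferInstanceAs (Fintype Bool)
      | some k => Fintype.ofFinite (tm.Γ k)
    Λ := Option tm.Λ
    main := none
    σ := tm.σ × Option Bool
    initialState := (tm.initialState, none)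
    m := fun l => match l with
      | none => Set.range (guessStmt tm i)
      | some l => {(guessEmb tm).tr (tm.m l)}
    finite_m := fun l => match l with
      | none => Set.finite_range _
      | some _ => Set.finite_singleton _
    inputAlphabet := Equiv.refl Bool
    outputAlphabet := o }

/-- The stacks of the machine while it guesses. -/
def guessStk (u w : Str) : ∀ k, List (OptAlph tm.Γ k)
  | none => u
  | some k => Function.update (fun _ => []) tm.k₀ (w.map i.symm) k

theorem stepAux_guessStmt_cons (b c : Bool) (x : Option Bool) (u w : Str) :
    stepAux (guessStmt tm i c) (tm.initialState, x) (guessStk tm i (b :: u) w) =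
      ⟨some none, (tm.initialState, some b), guessStk tm i u (b :: c :: w)⟩ := by
  simp only [guessStmt, stepAux, guessStk]
  simp only [List.head?_cons, Option.isSome_some, cond_true, Option.getD_some]
  congr 1
  funext k
  cases k with
  | none => simp [guessStk]
  | some k =>
    by_cases h : k = tm.k₀
    · subst h; simp [guessStk]
    · simp [guessStk, h]

theorem stepAux_guessStmt_nil (c : Bool) (x : Option Bool) (w : Str) :
    stepAux (guessStmt tm i c) (tm.initialState, x) (guessStk tm i [] w) =
      ⟨some (some tm.main), (tm.initialState, none), guessStk tm i [] w⟩ := by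
  simp only [guessStmt, stepAux, guessStk]
  simp only [List.head?_nil, Option.isSome_none, cond_false]
  congr 1
  funext k
  cases k with
  | none => simp [guessStk]
  | some k => simp [guessStk]

variable [∀ k, Finite (tm.Γ k)] (o : tm.Γ tm.k₁ ≃ Bool)

theorem step_guessNTM_cons (b : Bool) (x : Option Bool) (u w : Str) (d : (guessNTM tm i o).Cfg) :
    (guessNTM tm i o).Step ⟨some none, (tm.initialState, x), guessStk tm i (b :: u) w⟩ d ↔
      ∃ c, d = ⟨some none, (tm.initialState, some b), guessStk tm i u (b :: c :: w)⟩ := by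
  constructor
  · rintro ⟨l, hl, q, hq, rfl⟩
    cases hl
    obtain ⟨a, rfl⟩ := hq
    exact ⟨a, stepAux_guessStmt_cons tm i b a x u w⟩
  · rintro ⟨a, rfl⟩
    exact ⟨none, rfl, _, ⟨a, rfl⟩, (stepAux_guessStmt_cons tm i b a x u w).symm⟩

/-- Both guesses have the same successor here, because the guess is written only if an input symbol
was popped. -/
theorem step_guessNTM_nil (x : Option Bool) (w : Str) (d : (guessNTM tm i o).Cfg) :
    (guessNTM tm i o).Step ⟨some none, (tm.initialState, x), guessStk tm i [] w⟩ d ↔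
      d = ⟨some (some tm.main), (tm.initialState, none), guessStk tm i [] w⟩ := by
  constructor
  · rintro ⟨l, hl, q, hq, rfl⟩
    cases hl
    obtain ⟨a, rfl⟩ := hq
    exact stepAux_guessStmt_nil tm i a x w
  · rintro rfl
    exact ⟨none, rfl, _, ⟨true, rfl⟩, (stepAux_guessStmt_nil tm i true x w).symm⟩

/-- Once guessing is over, each label offers a single statement. The last clause, about all
computations, gives both the time bound and the fact that acceptance reflects the output of `tm`. -/
theorem stepsIn_guessNTM_det (v₀ : tm.σ × Option Bool) (S₀ : ∀ k, List (OptAlph tm.Γ k)) (n : ℕ)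
    (c d : TM2.Cfg tm.Γ tm.Λ tm.σ) (c' : (guessNTM tm i o).Cfg)
    (hc : (guessEmb tm).Rel v₀ S₀ c c') (h : Runs tm.m n c d) :
    ∃ d' : (guessNTM tm i o).Cfg, (guessNTM tm i o).StepsIn n c' d' ∧
      (guessEmb tm).Rel v₀ S₀ d d' ∧ (d.l = none → ∀ m e, (guessNTM tm i o).StepsIn m c' e →
        m ≤ n ∧ (e.l = none → e = d')) := by
  induction n generalizing c c' with
  | zero =>
    cases h
    refine ⟨c', rfl, hc, fun hl m e he => ?_⟩
    have hl' : c'.l = none := by rw [hc.l, hl]; rfl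
    cases m with
    | zero => exact ⟨le_rfl, fun _ => he.symm⟩
    | succ m =>
      obtain ⟨_, ⟨l, hm, _⟩, _⟩ := he
      rw [hl'] at hm
      cases hm
  | succ n ih =>
    obtain ⟨c₁, hc₁, h⟩ := h
    obtain ⟨l, v, S⟩ := c
    cases l with
    | none => simp at hc₁
    | some l =>
      simp only [step, Option.some.injEq] at hc₁
      subst hc₁
      obtain ⟨l', v', S'⟩ := c'
      obtain ⟨h1, h2, h3, h4⟩ := hc
      simp only [Option.elim] at h1 h2 h3 h4
      subst h1 h2
      have hrel := (guessEmb tm).rel_stepAux (v₀ := v₀) (S₀ := S₀) (tm.m l) v S S' h3 h4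
      obtain ⟨d', hd', hr, hdet⟩ := ih _ _ hrel h
      refine ⟨d', ⟨_, ⟨some l, rfl, _, rfl, rfl⟩, hd'⟩, hr, fun hl m e he => ?_⟩
      cases m with
      | zero =>
        refine ⟨Nat.zero_le _, fun hel => ?_⟩
        cases he
        cases hel
      | succ m =>
        obtain ⟨f, ⟨l', hl', q, hq, rfl⟩, he⟩ := he
        cases hl'
        cases hq
        obtain ⟨h5, h6⟩ := hdet hl m e he
        exact ⟨Nat.succ_le_succ h5, h6⟩

theorem stepsIn_guessNTM_guess (u c w : Str) (h : c.length = u.length) (x : Option Bool)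
    (m : ℕ) (e : (guessNTM tm i o).Cfg)
    (he : (guessNTM tm i o).StepsIn m ⟨some (some tm.main), (tm.initialState, none),
      guessStk tm i [] (weave u c w)⟩ e) :
    (guessNTM tm i o).StepsIn (u.length + 1 + m)
      ⟨some none, (tm.initialState, x), guessStk tm i u w⟩ e := by
  induction u generalizing c w x with
  | nil =>
    rw [List.length_nil, zero_add, add_comm]
    exact ⟨_, (step_guessNTM_nil tm i o x w _).2 rfl, he⟩
  | cons b u ih =>
    cases c with
    | nil => simp at h
    | cons a c =>
      rw [List.length_cons, show u.length + 1 + 1 + m = (u.length + 1 + m) + 1 by ring]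
      exact ⟨_, (step_guessNTM_cons tm i o b x u w _).2 ⟨a, rfl⟩,
        ih c _ (by simpa using h) _ he⟩

/-- Every computation either is still guessing, so that it is short and has not halted, or has fixed
a complete guess and is now running `tm`. -/
theorem of_stepsIn_guessNTM (u w : Str) (x : Option Bool) (m : ℕ) (e : (guessNTM tm i o).Cfg)
    (h : (guessNTM tm i o).StepsIn m ⟨some none, (tm.initialState, x), guessStk tm i u w⟩ e) :
    (m ≤ u.length ∧ e.l ≠ none) ∨ ∃ c : Str, c.length = u.length ∧ ∃ m', m = u.length + 1 + m' ∧
      (guessNTM tm i o).StepsIn m' ⟨some (some tm.main), (tm.initialState, none),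
        guessStk tm i [] (weave u c w)⟩ e := by
  induction u generalizing w x m with
  | nil =>
    cases m with
    | zero =>
      cases h
      exact Or.inl ⟨le_rfl, by simp⟩
    | succ m =>
      obtain ⟨f, hf, h⟩ := h
      obtain rfl := (step_guessNTM_nil tm i o x w f).1 hf
      exact Or.inr ⟨[], rfl, m, by simp [add_comm], h⟩
  | cons b u ih =>
    cases m with
    | zero =>
      cases h
      exact Or.inl ⟨Nat.zero_le _, by simp⟩
    | succ m =>
      obtain ⟨f, hf, h⟩ := h
      obtain ⟨a, rfl⟩ := (step_guessNTM_cons tm i o b x u w f).1 hf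
      obtain ⟨h1, h2⟩ | ⟨c, hc, m', rfl, h'⟩ := ih _ _ _ h
      · exact Or.inl ⟨Nat.succ_le_succ h1, h2⟩
      · exact Or.inr ⟨a :: c, by simp [hc], m', by simp; ring, h'⟩

end Guess

/-- Certificates as long as the input suffice, since the inputs to which this is applied can be
padded. -/
theorem guess_mem_classNP {V : Str → Str} (hV : PT V) :
    {u : Str | ∃ c : Str, c.length = u.length ∧ V (weave u c []) = [true]} ∈ ClassNP := by
  obtain ⟨C, hC⟩ := hV
  let N := guessNTM C.tm C.inputAlphabet C.outputAlphabet
  have hinit : ∀ u, N.init u = ⟨some none, (C.tm.initialState, none),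
      guessStk C.tm C.inputAlphabet u []⟩ := by
    intro u
    unfold NTM.init
    congr 1
    funext k
    cases k with
    | none => exact (Function.update_self _ _ _).trans (List.map_id _)
    | some k =>
      exact (Function.update_of_ne (by rintro ⟨⟩) _ _).trans
        (congrFun (Function.update_eq_self (β := fun k => List (C.tm.Γ k)) C.tm.k₀ fun _ => []) k).symm
  have hrun : ∀ w : Str, ∃ n ≤ C.time.eval w.length, ∃ d' : N.Cfg,
      N.StepsIn n ⟨some (some C.tm.main), (C.tm.initialState, none),
        guessStk C.tm C.inputAlphabet [] w⟩ d' ∧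
      (N.IsAccepting d' ↔ V w = [true]) ∧ d'.l = none ∧
      ∀ m e, N.StepsIn m ⟨some (some C.tm.main), (C.tm.initialState, none),
        guessStk C.tm C.inputAlphabet [] w⟩ e → m ≤ n ∧ (e.l = none → e = d') := by
    intro w
    obtain ⟨n, hn, hr⟩ := exists_runs_of_outputsInTime (C.outputsFun w)
    obtain ⟨d', h1, h2, h3⟩ := stepsIn_guessNTM_det C.tm C.inputAlphabet C.outputAlphabet
      (C.tm.initialState, none) (fun _ => []) n _ _
      ⟨some (some C.tm.main), (C.tm.initialState, none), guessStk C.tm C.inputAlphabet [] w⟩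
      ⟨rfl, rfl, fun k => (List.map_id _).symm, by
        rintro (_ | k) hk
        · rfl
        · exact (hk ⟨k, rfl⟩).elim⟩ hr
    refine ⟨n, hn, d', h1, ?_, h2.l, h3 rfl⟩
    have h4 : d'.stk (some C.tm.k₁) = (V w).map C.outputAlphabet.symm := by
      refine (h2.stk C.tm.k₁).trans ((List.map_id _).trans ?_)
      simp
    have h5 : N.IsAccepting d' ↔ d'.l = none ∧
      d'.stk (some C.tm.k₁) = [C.outputAlphabet.symm true] := Iff.rfl
    have h6 : (V w).map C.outputAlphabet.symm = [C.outputAlphabet.symm true] ↔ V w = [true] :=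
      (List.map_injective_iff.2 (Equiv.injective _)).eq_iff (b := [true])
    exact h5.trans ⟨fun h => h6.1 (h4.symm.trans h.2), fun h => ⟨h2.l, h4.trans (h6.2 h)⟩⟩
  -- Guessing takes `|x| + 1` steps, and the verifier then runs on a woven string of length `2 |x|`.
  refine ⟨N, ⟨X + 1 + C.time.comp (2 * X), fun x n c h => ?_⟩, fun x => ⟨?_, ?_⟩⟩
  · rw [hinit] at h
    have e : (X + 1 + C.time.comp (2 * X)).eval x.length =
        x.length + 1 + C.time.eval (2 * x.length) := by simp
    rw [e]
    obtain ⟨h1, -⟩ | ⟨g, hg, m', rfl, h'⟩ := of_stepsIn_guessNTM _ _ _ _ _ _ _ _ h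
    · omega
    · obtain ⟨k, hk, d', -, -, -, hd⟩ := hrun (weave x g [])
      rw [length_weave _ _ _ hg] at hk
      have := (hd _ _ h').1
      simp only [List.length_nil, add_zero] at hk
      omega
  · rintro ⟨n, c, h, hacc⟩
    rw [hinit] at h
    obtain ⟨-, h2⟩ | ⟨g, hg, m', rfl, h'⟩ := of_stepsIn_guessNTM _ _ _ _ _ _ _ _ h
    · exact (h2 hacc.1).elim
    · obtain ⟨k, hk, d', -, hd', -, hd⟩ := hrun (weave x g [])
      refine ⟨g, hg, hd'.1 ?_⟩
      rw [← (hd _ _ h').2 hacc.1]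
      exact hacc
  · rintro ⟨g, hg, hV⟩
    obtain ⟨k, hk, d', h1, hd', -, -⟩ := hrun (weave x g [])
    exact ⟨_, d', by rw [hinit]; exact stepsIn_guessNTM_guess _ _ _ _ _ _ hg _ _ _ h1, hd'.2 hV⟩

/-! ### Verification of nondeterministic computations -/

/-- Decoding of a string of tagged bits: the bits with tag `1` and those with tag `0`, both
reversed. -/
def untag : Str → Str → Str → Option (Str × Str)
  | [], x, w => some (x, w)
  | [_], _, _ => none
  | true :: b :: z, x, w => untag z (b :: x) w
  | false :: b :: z, x, w => untag z x (b :: w)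

/-- Each decoded bit costs two symbols, so an encoded pair has length linear in its parts. This
enters the balance of `inputOf`. -/
theorem length_untag {z x w x' w' : Str} (h : untag z x w = some (x', w')) :
    2 * (x'.length + w'.length) = 2 * (x.length + w.length) + z.length := by
  induction z, x, w using untag.induct with
  | case1 x w => simp [untag] at h; simp [h]
  | case2 => simp [untag] at h
  | case3 x w b z ih =>
    rw [ih (by simpa [untag] using h)]
    simp
    ring
  | case4 x w b z ih =>
    rw [ih (by simpa [untag] using h)]
    simp
    ring

/-- Decoding reverses, so bits are appended at the end of the code: first those of `w`, then those
of `x`. -/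
theorem exists_untag (x w : Str) : ∃ z, untag z [] [] = some (x, w) := by
  have h1 : ∀ w : Str, ∃ z, ∀ z', untag (z ++ z') [] [] = untag z' [] w := by
    intro w
    induction w with
    | nil => exact ⟨[], fun _ => rfl⟩
    | cons b w ih =>
      obtain ⟨z, hz⟩ := ih
      exact ⟨z ++ [false, b], fun z' => by rw [List.append_assoc, hz]; rfl⟩
  have h2 : ∀ x : Str, ∃ z, ∀ z', untag (z ++ z') [] [] = untag z' x w := by
    intro x
    induction x with
    | nil => exact h1 w
    | cons b x ih =>
      obtain ⟨z, hz⟩ := ih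
      exact ⟨z ++ [true, b], fun z' => by rw [List.append_assoc, hz]; rfl⟩
  obtain ⟨z, hz⟩ := h2 x
  exact ⟨z, by simpa [untag] using hz []⟩

namespace NTM

variable (N : NTM)

/-- The statements to choose from at a label. -/
noncomputable def choices (l : N.Λ) : List (Stmt N.Γ N.Λ N.σ) := (N.finite_m l).toFinset.toList

theorem mem_choices (l : N.Λ) (q : Stmt N.Γ N.Λ N.σ) : q ∈ N.choices l ↔ q ∈ N.m l := by
  simp [choices]

theorem exists_length_choices_le : ∃ B, ∀ l, (N.choices l).length ≤ B := by
  have := N.finΛ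
  obtain ⟨B, hB⟩ := (Set.finite_range fun l => (N.choices l).length).bddAbove
  exact ⟨B, fun l => hB ⟨l, rfl⟩⟩

/-- Does the computation given by a string of bits accept? Each choice is a number, written in
unary. -/
noncomputable def follow (B : ℕ) : Str → N.Λ → ℕ → N.σ → (∀ k, List (N.Γ k)) → Bool
  | [], _, _, _, _ => false
  | true :: w, l, i, v, S => if i < B then follow B w l (i + 1) v S else false
  | false :: w, l, i, v, S => match (N.choices l)[i]? with
    | none => false
    | some q => match (stepAux q v S).l with
      | none => decide (w = [] ∧ ((stepAux q v S).stk N.k₁).map N.outputAlphabet = [true])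
      | some l' => follow B w l' 0 (stepAux q v S).var (stepAux q v S).stk

/-- One step of `N` is encoded by at most `B` ones and a closing zero, and `i` counts the ones
already read for the current step. Because acceptance requires the code to be used up, an accepted
code is no longer than `(B + 1) * n`, which bounds encoded computations in terms of the input. -/
theorem stepsIn_of_follow (B : ℕ) (w : Str) (l : N.Λ) (i : ℕ) (v : N.σ)
    (S : ∀ k, List (N.Γ k)) (hi : i ≤ B) (h : N.follow B w l i v S = true) :
    ∃ n c, N.StepsIn n ⟨some l, v, S⟩ c ∧ N.IsAccepting c ∧ w.length + i ≤ (B + 1) * n := by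
  induction w generalizing l i v S with
  | nil => simp [follow] at h
  | cons b w ih =>
    cases b with
    | true =>
      simp only [follow] at h
      split_ifs at h with hB
      obtain ⟨n, c, h1, h2, h3⟩ := ih l (i + 1) v S hB h
      exact ⟨n, c, h1, h2, by rw [List.length_cons]; omega⟩
    | false =>
      simp only [follow] at h
      cases hq : (N.choices l)[i]? with
      | none => simp [hq] at h
      | some q =>
        have hm : q ∈ N.m l := (N.mem_choices l q).1 (List.mem_of_getElem? hq)
        simp only [hq] at h
        cases hl : (stepAux q v S).l with
        | none =>
          simp only [hl, decide_eq_true_eq] at h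
          refine ⟨1, _, ⟨_, ⟨l, rfl, q, hm, rfl⟩, rfl⟩, ⟨hl, ?_⟩, by simp [h.1]; omega⟩
          have := congrArg (List.map N.outputAlphabet.symm) h.2
          simpa using this
        | some l' =>
          simp only [hl] at h
          obtain ⟨n, c, h1, h2, h3⟩ := ih l' 0 _ _ (Nat.zero_le _) h
          refine ⟨n + 1, c, ⟨_, ⟨l, rfl, q, hm, rfl⟩, ?_⟩, h2, ?_⟩
          · have e : stepAux q v S = ⟨some l', (stepAux q v S).var, (stepAux q v S).stk⟩ := by
              rw [← hl]
            rw [e]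
            exact h1
          · rw [List.length_cons, Nat.mul_succ]
            omega

theorem follow_replicate (B : ℕ) (w : Str) (l : N.Λ) (i j : ℕ) (v : N.σ)
    (S : ∀ k, List (N.Γ k)) (h : i + j ≤ B) :
    N.follow B (List.replicate j true ++ w) l i v S = N.follow B w l (i + j) v S := by
  induction j generalizing i with
  | zero => simp
  | succ j ih =>
    simp only [List.replicate_succ, List.cons_append, follow]
    rw [if_pos (by omega), ih _ (by omega), Nat.add_assoc, Nat.add_comm 1 j]

/-- A choice at position `i` of the list is written as `i` ones followed by a zero; `hB` ensures
that the counter never overflows. -/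
theorem exists_follow {B : ℕ} (hB : ∀ l, (N.choices l).length ≤ B) (n : ℕ) (l : N.Λ) (v : N.σ)
    (S : ∀ k, List (N.Γ k)) (c : N.Cfg) (h : N.StepsIn n ⟨some l, v, S⟩ c)
    (hc : N.IsAccepting c) : ∃ w, N.follow B w l 0 v S = true := by
  induction n generalizing l v S with
  | zero =>
    cases h
    cases hc.1
  | succ n ih =>
    obtain ⟨d, ⟨l', hl', q, hq, rfl⟩, h⟩ := h
    cases hl'
    obtain ⟨i, hi, hiq⟩ := List.getElem_of_mem ((N.mem_choices l q).2 hq)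
    have hqi : (N.choices l)[i]? = some q := by rw [List.getElem?_eq_getElem hi, hiq]
    have key : ∀ w, N.follow B (List.replicate i true ++ w) l 0 v S = N.follow B w l i v S := by
      intro w
      rw [follow_replicate _ _ _ _ _ _ _ _ (by have := hB l; omega), Nat.zero_add]
    cases hl : (stepAux q v S).l with
    | none =>
      refine ⟨List.replicate i true ++ [false], ?_⟩
      rw [key]
      simp only [follow, hqi, hl]
      cases n with
      | zero =>
        cases h
        have := hc.2
        simp only at this
        simp [this]
      | succ n =>
        obtain ⟨_, ⟨l', hl', _⟩, _⟩ := h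
        simp only at hl'
        rw [hl] at hl'
        cases hl'
    | some l' =>
      have e : stepAux q v S = ⟨some l', (stepAux q v S).var, (stepAux q v S).stk⟩ := by
        rw [← hl]
      simp only at h
      rw [e] at h
      obtain ⟨w, hw⟩ := ih _ _ _ h
      refine ⟨List.replicate i true ++ false :: w, ?_⟩
      rw [key]
      simp only [follow, hqi, hl]
      exact hw

/-- The checker for strings that consist of an input and a computation. -/
noncomputable def verify (B : ℕ) (z : Str) : Bool :=
  match untag z [] [] with
  | none => false
  | some (x, w) => N.follow B w N.main 0 N.initialState (N.init x).stk

end NTM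

section Verify

variable (N : NTM) (B : ℕ)

/-- Statements of `N` as statements of the checker. -/
def verifyEmb : Emb N.Γ (Alph (Fin 3) N.Γ) N.Λ ((N.Λ × Fin (B + 1)) ⊕ Fin 3) N.σ
    (N.σ × Option Bool × Option Bool) where
  e := Sum.inr
  inj := Sum.inr_injective
  φ _ := Equiv.refl _
  lab l := Sum.inl (l, 0)
  ex := some (Sum.inr 1)
  get s := s.1
  set s t := (t, s.2)
  get_set _ _ := rfl
  set_set _ _ _ := rfl

/-- Write the answer and halt. -/
def answer (b : Bool) : Stmt (Alph (Fin 3) N.Γ) ((N.Λ × Fin (B + 1)) ⊕ Fin 3)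
    (N.σ × Option Bool × Option Bool) :=
  Stmt.push (Sum.inl 2) (fun _ => b) Stmt.halt

/-- The program of the checker. -/
noncomputable def verifyStmt : (N.Λ × Fin (B + 1)) ⊕ Fin 3 →
    Stmt (Alph (Fin 3) N.Γ) ((N.Λ × Fin (B + 1)) ⊕ Fin 3) (N.σ × Option Bool × Option Bool)
  | Sum.inl (l, i) =>
    Stmt.pop (Sum.inl 1) (fun s x => (s.1, x, s.2.2)) <|
    Stmt.branch (fun s => s.2.1.isSome)
      (Stmt.branch (fun s => s.2.1.getD false)
        (Stmt.goto fun _ => if h : i.1 < B then Sum.inl (l, ⟨i.1 + 1, Nat.succ_lt_succ h⟩)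
          else Sum.inr 2)
        (match (N.choices l)[i.1]? with
          | some q => (verifyEmb N B).tr q
          | none => answer N B false))
      (answer N B false)
  | Sum.inr 0 =>
    Stmt.pop (Sum.inl 0) (fun s x => (s.1, x, s.2.2)) <|
    Stmt.branch (fun s => s.2.1.isSome)
      (Stmt.pop (Sum.inl 0) (fun s x => (s.1, s.2.1, x)) <|
        Stmt.branch (fun s => s.2.2.isSome)
          (Stmt.branch (fun s => s.2.1.getD false)
            (Stmt.push (Sum.inr N.k₀) (fun s => N.inputAlphabet.symm (s.2.2.getD false)) <|
              Stmt.goto fun _ => Sum.inr 0)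
            (Stmt.push (Sum.inl 1) (fun s => s.2.2.getD false) <| Stmt.goto fun _ => Sum.inr 0))
          (answer N B false))
      (Stmt.goto fun _ => Sum.inl (N.main, 0))
  | Sum.inr 1 =>
    Stmt.pop (Sum.inl 1) (fun s x => (s.1, x, s.2.2)) <|
    Stmt.branch (fun s => s.2.1.isSome)
      (answer N B false)
      (Stmt.pop (Sum.inr N.k₁) (fun s x => (s.1, s.2.1, x.map N.outputAlphabet)) <|
        Stmt.branch (fun s => s.2.2.getD false)
          (Stmt.pop (Sum.inr N.k₁) (fun s x => (s.1, s.2.1, x.map N.outputAlphabet)) <|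
            Stmt.branch (fun s => s.2.2.isSome) (answer N B false) (answer N B true))
          (answer N B false))
  | Sum.inr 2 => answer N B false

/-- The three binary stacks of the checker: input, choices, answer. -/
def st₃ (a b c : Str) : Fin 3 → Str := ![a, b, c]

@[simp] theorem st₃_apply_0 (a b c : Str) : st₃ a b c 0 = a := rfl
@[simp] theorem st₃_apply_1 (a b c : Str) : st₃ a b c 1 = b := rfl
@[simp] theorem st₃_apply_2 (a b c : Str) : st₃ a b c 2 = c := rfl
@[simp] theorem update_st₃_0 (a b c x : Str) : Function.update (st₃ a b c) 0 x = st₃ x b c := by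
  funext k; fin_cases k <;> rfl
@[simp] theorem update_st₃_1 (a b c x : Str) : Function.update (st₃ a b c) 1 x = st₃ a x c := by
  funext k; fin_cases k <;> rfl
@[simp] theorem update_st₃_2 (a b c x : Str) : Function.update (st₃ a b c) 2 x = st₃ a b x := by
  funext k; fin_cases k <;> rfl

@[simp] theorem mix_inl {R P : Type} {Γ : P → Type} (S : R → Str) (T : ∀ p, List (Γ p)) (r : R) :
    mix S T (Sum.inl r) = S r := rfl

@[simp] theorem mix_inr {R P : Type} {Γ : P → Type} (S : R → Str) (T : ∀ p, List (Γ p)) (p : P) :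
    mix S T (Sum.inr p) = T p := rfl

/-- The checker gives the answer `b` in at most `n` steps. -/
def Answers (n : ℕ) (c : Cfg (Alph (Fin 3) N.Γ) ((N.Λ × Fin (B + 1)) ⊕ Fin 3)
    (N.σ × Option Bool × Option Bool)) (b : Bool) : Prop :=
  ∃ k ≤ n, ∃ v T, Runs (verifyStmt N B) k c ⟨none, v, T⟩ ∧ T (Sum.inl 2) = [b]

variable {N B}

theorem Answers.of_stepAux {l v S b} (h : ∃ v' T, stepAux (verifyStmt N B l) v S = ⟨none, v', T⟩ ∧
    T (Sum.inl 2) = [b]) : Answers N B 1 ⟨some l, v, S⟩ b := by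
  obtain ⟨v', T, h1, h2⟩ := h
  exact ⟨1, le_rfl, v', T, Runs.of_stepAux h1, h2⟩

theorem Answers.step {n : ℕ} {l v S c b} (h : stepAux (verifyStmt N B l) v S = c)
    (hc : Answers N B n c b) : Answers N B (n + 1) ⟨some l, v, S⟩ b := by
  obtain ⟨k, hk, v', T, h1, h2⟩ := hc
  exact ⟨1 + k, by omega, v', T, (Runs.of_stepAux h).trans h1, h2⟩

theorem Answers.mono {m n : ℕ} {c b} (hc : Answers N B m c b) (h : m ≤ n) : Answers N B n c b := by
  obtain ⟨k, hk, h1⟩ := hc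
  exact ⟨k, hk.trans h, h1⟩

theorem stepAux_answer (b : Bool) (v : N.σ × Option Bool × Option Bool) (a w : Str)
    (S : ∀ k, List (N.Γ k)) : stepAux (answer N B b) v (mix (st₃ a w []) S) =
      ⟨none, v, mix (st₃ a w [b]) S⟩ := by
  simp [answer, update_mix_inl]

/-- Unused choices lead to rejection. Two pops of the output stack check that it holds exactly the
symbol `1`. -/
theorem answers_halted (v : N.σ × Option Bool × Option Bool) (w : Str) (S : ∀ k, List (N.Γ k)) :
    Answers N B 1 ⟨some (Sum.inr 1), v, mix (st₃ [] w []) S⟩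
      (decide (w = [] ∧ (S N.k₁).map N.outputAlphabet = [true])) := by
  refine Answers.of_stepAux ?_
  simp only [verifyStmt, stepAux, update_mix_inl, update_mix_inr, mix_inl, mix_inr, st₃_apply_1,
    update_st₃_1]
  cases w with
  | cons b w => simp [stepAux_answer]
  | nil =>
    simp only [List.head?_nil, Option.isSome_none, cond_false, List.tail_nil, true_and,
      Function.update_self]
    cases h : S N.k₁ with
    | nil => simp [stepAux_answer]
    | cons a T =>
      cases ha : N.outputAlphabet a with
      | false => simp [stepAux_answer, ha]
      | true =>
        cases T with
        | nil => simp [stepAux_answer, ha]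
        | cons => simp [stepAux_answer, ha]

theorem answers_reject (v : N.σ × Option Bool × Option Bool) (a w : Str)
    (S : ∀ k, List (N.Γ k)) :
    Answers N B 1 ⟨some (Sum.inr 2), v, mix (st₃ a w []) S⟩ false := by
  refine Answers.of_stepAux ?_
  simp [verifyStmt, stepAux_answer]

/-- The checker needs one step per symbol of `w`, because the chosen statement of `N` is executed in
the same step that reads the closing zero. -/
theorem answers_follow (w : Str) (l : N.Λ) (i : Fin (B + 1)) (v : N.σ) (x : Option Bool × Option Bool)
    (S : ∀ k, List (N.Γ k)) :
    Answers N B (w.length + 2) ⟨some (Sum.inl (l, i)), (v, x), mix (st₃ [] w []) S⟩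
      (N.follow B w l i.1 v S) := by
  induction w generalizing l i v x S with
  | nil =>
    refine (Answers.of_stepAux ?_).mono (Nat.le_add_left 1 _)
    simp only [verifyStmt, stepAux, update_mix_inl, mix_inl, st₃_apply_1, update_st₃_1]
    simp [stepAux_answer, NTM.follow]
  | cons b w ih =>
    cases b with
    | true =>
      have e : stepAux (verifyStmt N B (Sum.inl (l, i))) (v, x) (mix (st₃ [] (true :: w) []) S) =
          ⟨some (if h : i.1 < B then Sum.inl (l, ⟨i.1 + 1, Nat.succ_lt_succ h⟩) else Sum.inr 2),
            (v, some true, x.2), mix (st₃ [] w []) S⟩ := by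
        simp [verifyStmt, update_mix_inl]
      simp only [NTM.follow]
      split_ifs at e ⊢ with h
      · exact Answers.step e (ih l ⟨i.1 + 1, Nat.succ_lt_succ h⟩ v _ S)
      · exact Answers.step e ((answers_reject _ _ _ _).mono (by simp))
    | false =>
      have e : stepAux (verifyStmt N B (Sum.inl (l, i))) (v, x) (mix (st₃ [] (false :: w) []) S) =
          stepAux (match (N.choices l)[i.1]? with
            | some q => (verifyEmb N B).tr q
            | none => answer N B false) (v, some false, x.2) (mix (st₃ [] w []) S) := by
        simp [verifyStmt, update_mix_inl]
      simp only [NTM.follow]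
      cases hq : (N.choices l)[i.1]? with
      | none =>
        rw [hq] at e
        refine (Answers.of_stepAux ?_).mono (Nat.le_add_left 1 _)
        rw [e]
        simp [stepAux_answer]
      | some q =>
        rw [hq] at e
        simp only at e ⊢
        -- A single statement is simulated, in place, while the three binary stacks form the frame
        -- that stays unchanged.
        obtain ⟨h1, h2, h3, h4⟩ := (verifyEmb N B).rel_stepAux (v₀ := (v, some false, x.2))
          (S₀ := mix (st₃ [] w []) S) q v S (mix (st₃ [] w []) S) (fun k => (List.map_id _).symm)
          (fun _ _ => rfl)
        have e' : stepAux ((verifyEmb N B).tr q) (v, some false, x.2) (mix (st₃ [] w []) S) =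
            ⟨(stepAux q v S).l.elim (some (Sum.inr 1)) fun l => some (Sum.inl (l, 0)),
              ((stepAux q v S).var, some false, x.2),
              mix (st₃ [] w []) (stepAux q v S).stk⟩ := by
          have hs : (stepAux ((verifyEmb N B).tr q) (v, some false, x.2)
              (mix (st₃ [] w []) S)).stk = mix (st₃ [] w []) (stepAux q v S).stk := by
            funext k
            obtain k | k := k
            · exact h4 _ (by rintro ⟨_, h⟩; cases h)
            · exact (h3 k).trans (List.map_id _)
          rw [← hs]
          change _ = (⟨_, (verifyEmb N B).set (v, some false, x.2) (stepAux q v S).var, _⟩ : Cfg _ _ _)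
          rw [← h2]
          change _ = (⟨(stepAux q v S).l.elim (verifyEmb N B).ex fun l =>
            some ((verifyEmb N B).lab l), _, _⟩ : Cfg _ _ _)
          rw [← h1]
          rfl
        rw [e'] at e
        cases hl : (stepAux q v S).l with
        | none =>
          rw [hl] at e
          exact (Answers.step e (answers_halted _ _ _)).mono (by simp)
        | some l' =>
          rw [hl] at e
          exact Answers.step e (ih l' 0 _ _ _)

/-- Each decoding step removes two symbols from `z` and adds at most one to `w`, so the bound
decreases. The decoded input is written directly on the input stack of `N`, which thereby reaches
its initial contents. -/
theorem answers_untag (z x w : Str) (y : Option Bool × Option Bool) :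
    Answers N B (2 * z.length + w.length + 3) ⟨some (Sum.inr 0), (N.initialState, y),
        mix (st₃ z w []) (N.init x).stk⟩
      (match untag z x w with
        | none => false
        | some (x, w) => N.follow B w N.main 0 N.initialState (N.init x).stk) := by
  induction z, x, w using untag.induct generalizing y with
  | case1 x w =>
    refine (Answers.step ?_ (answers_follow w N.main 0 N.initialState (none, y.2) _)).mono
      (by simp)
    simp [verifyStmt, update_mix_inl]
  | case2 x w b =>
    refine (Answers.of_stepAux ?_).mono (Nat.le_add_left 1 _)
    cases b <;> simp [verifyStmt, update_mix_inl, stepAux_answer, untag]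
  | case3 b z x w ih =>
    refine (Answers.step ?_ (ih (some true, some b))).mono (by simp)
    simp [verifyStmt, update_mix_inl, update_mix_inr, NTM.init]
  | case4 b z x w ih =>
    refine (Answers.step ?_ (ih (some false, some b))).mono (by simp; omega)
    simp [verifyStmt, update_mix_inl]

/-- The simulated machine leaves its stacks as they are, so only the sloppy form of computability is
available; a subroutine call needs no more. -/
theorem sloppy_verify (N : NTM) (B : ℕ) : Sloppy fun z => [N.verify B z] := by
  let _ := N.finK
  let _ := N.finΛ
  let _ := N.finσ
  let _ := N.finΓ
  refine ⟨{ K := Fin 3 ⊕ N.K, k₀ := Sum.inl 0, k₁ := Sum.inl 2, Γ := Alph (Fin 3) N.Γ,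
            Λ := (N.Λ × Fin (B + 1)) ⊕ Fin 3, main := Sum.inr 0,
            σ := N.σ × Option Bool × Option Bool, initialState := (N.initialState, none, none),
            m := verifyStmt N B, Γk₀Fin := inferInstanceAs (Fintype Bool) }, ?_,
    Equiv.refl Bool, Equiv.refl Bool, 2 * X + 3, fun z => ?_⟩
  · rintro (k | k)
    · exact inferInstanceAs (Finite Bool)
    · exact inferInstanceAs (Finite (N.Γ k))
  · obtain ⟨k, hk, v, T, h1, h2⟩ := answers_untag (N := N) (B := B) z [] [] (none, none)
    have e : (2 * X + 3 : ℕ[X]).eval z.length = 2 * z.length + 3 := by simp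
    rw [e]
    refine ⟨k, by simpa using hk, v, T, ?_, h2⟩
    have e2 : (Function.update (fun _ => []) (Sum.inl 0) z :
        ∀ k, List (Alph (Fin 3) N.Γ k)) = mix (st₃ z [] []) (N.init []).stk := by
      have : (N.init []).stk = fun _ => [] := Function.update_eq_self (β := fun k => List (N.Γ k)) _ _
      rw [this, ← update_st₃_0 [] [] [] z, ← update_mix_inl]
      congr 1
      funext k
      obtain k | k := k
      · fin_cases k <;> rfl
      · rfl
    rw [← e2] at h1
    convert h1 using 3
    exact List.map_id _

end Verify

/-! ### Strings of pairs of bits -/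

/-- Apply `φ` to all pairs of bits in a string, and push the values on another one. -/
def filterPairs (φ : Bool → Bool → Option Bool) : Str → Str → Str
  | a :: b :: z, x => filterPairs φ z ((φ a b).toList ++ x)
  | _, x => x

/-- The selection of the pairs with tag `t`. -/
def sel (t a b : Bool) : Option Bool := if a = t then some b else none

theorem PT.filterPairs (φ : Bool → Bool → Option Bool) : PT fun z => filterPairs φ z [] := by
  let next : Str × Str → Str × Str := fun b => match b with
    | (a :: b :: z, x) => (z, (φ a b).toList ++ x)
    | (_, x) => ([], x)
  have main := Tr.loop (0 : Fin 8) (s := fun b : Str × Str => st b.1 b.2 [] [] [] [] [] []) next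
    (fun b => ([], PolyFun.filterPairs φ b.1 b.2)) ?_ ?_ ?_ ?_ (fun b => b.1.length + b.2.length)
    ?_ ?_ X ?_
  -- The two moves return the result to register 0 without changing its order.
  · refine PT.of_tr_st (((((main.comap fun z : Str => (z, [])).mono fun _ _ => trivial).trans
      (Tr.moveRev _ _ (r := 1) (q := 2) (by decide))).trans
      (Tr.moveRev _ _ (r := 2) (q := 0) (by decide))).to_eq (by simp))
  · refine Tr.casesBool 0 ?_ fun a => ?_
    · exact (Tr.refl _ _).congr (fun _ h => h) (fun _ _ => rfl) fun a ha => absurd ha.2 ha.1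
    · refine (Tr.pop _ _ 0).trans (Tr.casesBool 0 ?_ fun b => ?_)
      · refine (Tr.refl _ _).to_eq ?_
        rintro ⟨z, x⟩ h
        cases z with
        | nil => simp at h
        | cons a z => simp at h; simp [next, h]
      · cases hφ : φ a b with
        | none =>
          refine (Tr.pop _ _ 0).to_eq ?_
          rintro ⟨z, x⟩ h
          rcases z with _ | ⟨a, _ | ⟨c, z⟩⟩
          · simp at h
          · simp at h
          · simp at h; simp [next, h, hφ]
        | some d =>
          refine ((Tr.pop _ _ 0).trans (Tr.push _ _ 1 d)).to_eq ?_
          rintro ⟨z, x⟩ h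
          rcases z with _ | ⟨a, _ | ⟨c, z⟩⟩
          · simp at h
          · simp at h
          · simp at h; simp [next, h, hφ]
  · rintro ⟨z, x⟩ h
    simp at h
    simp [h, PolyFun.filterPairs]
  · rintro ⟨z, x⟩ h
    rcases z with _ | ⟨a, _ | ⟨c, z⟩⟩
    · simp at h
    · simp [next, PolyFun.filterPairs]
    · simp [next, PolyFun.filterPairs]
  · rintro ⟨z, x⟩ h
    rcases z with _ | ⟨a, _ | ⟨c, z⟩⟩
    · simp at h
    · simp [next]
    · simp [next]
  · simp [size_st]
  · rintro ⟨z, x⟩ h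
    rcases z with _ | ⟨a, _ | ⟨c, z⟩⟩
    · simp at h
    · simp [next]
    · cases h : φ a c <;> simp [next, h] <;> omega
  · simp [size_st]

/-! ### Regularity of `fP` implies `P = NP` -/

/-- The input inside an encoded computation is extracted by tag alone, so the checker only has to
produce a verdict. -/
theorem filterPairs_of_untag {z x w x' w' : Str} (h : untag z x w = some (x', w')) :
    filterPairs (sel true) z x = x' := by
  induction z, x, w using untag.induct with
  | case1 x w => simp [untag] at h; simp [filterPairs, h]
  | case2 => simp [untag] at h
  | case3 b z x w ih => exact ih (by simpa [untag] using h)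
  | case4 b z x w ih => exact ih (by simpa [untag] using h)

namespace NTM

variable (N : NTM) (B : ℕ)

/-- The partial function that maps an accepting computation to the input. -/
noncomputable def inputOf (z : Str) : Option Str :=
  if N.verify B z then some (filterPairs (sel true) z []) else none

theorem pt_inputOf : PT fun z => encodeResult (N.inputOf B z) := by
  refine PT.of_tr_st ?_
  refine (Tr.copy _ _ (r := 0) (q := 1) (t := 2) (by decide) (by decide) (by decide)
    (by simp)).trans ((Tr.call (sloppy_verify N B) _ _ (r := 1) (t := 2) (by decide)
    (by simp)).trans (Tr.casesBool 1 ?_ fun b => ?_))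
  · exact (Tr.refl _ _).congr (fun _ h => h) (fun _ _ => rfl) fun a ha => by simp at ha
  · cases b
    · refine ((Tr.clear _ _ 1).trans (Tr.setBit _ _ 0 false)).to_eq fun z hz => ?_
      simp at hz
      simp [inputOf, hz, encodeResult]
    · refine (((Tr.clear _ _ 1).trans (Tr.call (PT.filterPairs (sel true)).sloppy _ _ (r := 0)
        (t := 1) (by decide) (by simp))).trans (Tr.push _ _ 0 true)).to_eq fun z hz => ?_
      simp at hz
      simp [inputOf, hz, encodeResult]

variable {N B}

theorem inputOf_eq_some {z x : Str} (h : N.inputOf B z = some x) :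
    ∃ w, untag z [] [] = some (x, w) ∧
      N.follow B w N.main 0 N.initialState (N.init x).stk = true := by
  unfold inputOf at h
  split_ifs at h with hv
  unfold verify at hv
  cases hu : untag z [] [] with
  | none => simp [hu] at hv
  | some p =>
    obtain ⟨x', w⟩ := p
    rw [hu] at hv
    rw [filterPairs_of_untag hu] at h
    cases h
    exact ⟨w, rfl, hv⟩

theorem exists_inputOf (hB : ∀ l, (N.choices l).length ≤ B) {x : Str} (h : N.Accepts x) :
    ∃ z, N.inputOf B z = some x := by
  obtain ⟨n, c, hs, hc⟩ := h
  obtain ⟨w, hw⟩ := N.exists_follow hB n _ _ _ c hs hc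
  obtain ⟨z, hz⟩ := exists_untag x w
  refine ⟨z, ?_⟩
  simp only [inputOf, verify, hz, filterPairs_of_untag hz]
  exact if_pos hw

theorem accepts_of_inputOf {z x : Str} (h : N.inputOf B z = some x) : N.Accepts x := by
  obtain ⟨w, -, hw⟩ := inputOf_eq_some h
  obtain ⟨n, c, h1, h2, -⟩ := N.stepsIn_of_follow B w _ 0 _ _ (Nat.zero_le _) hw
  exact ⟨n, c, h1, h2⟩

/-- The input is part of the code, hence not longer. Conversely, the code has length twice that of
input plus choices, and an accepting run on `x` has at most `p |x|` steps with at most `B + 1`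
symbols each. -/
theorem inputOf_mem_fP (hN : N.IsPolyTime) (B : ℕ) :
    (fun z => (N.inputOf B z : Part Str) : Str →. Str) ∈ fP := by
  obtain ⟨p, hp⟩ := hN
  refine (mem_fP_iff _).2
    ⟨⟨X, 2 * (X + (B + 1 : ℕ[X]) * p), fun z x hx => ?_⟩, _, fun _ => rfl, pt_inputOf N B⟩
  obtain ⟨w, hu, hw⟩ := inputOf_eq_some (show N.inputOf B z = some x by simpa using hx)
  obtain ⟨n, c, h1, -, h2⟩ := N.stepsIn_of_follow B w _ 0 _ _ (Nat.zero_le _) hw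
  have h3 := length_untag hu
  simp only [List.length_nil, Nat.mul_zero, Nat.zero_add, Nat.add_zero] at h3 h2
  have h4 := Nat.mul_le_mul_left (B + 1) (hp x n c h1)
  have e : (2 * (X + (B + 1 : ℕ[X]) * p)).eval x.length =
      2 * (x.length + (B + 1) * p.eval x.length) := by simp
  rw [e, eval_X]
  omega

end NTM

/-! ### Deciding images, and `NP ⊆ P` -/

theorem pt_decide_of_classP {L : Language Bool} (hL : L ∈ ClassP) :
    ∃ h : Str → Str, PT h ∧ ∀ x, (h x = [true] ∨ h x = [false]) ∧ (h x = [true] ↔ x ∈ L) := by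
  obtain ⟨χ, h1, h2⟩ := hL
  rw [detPolyTime_iff] at h2
  refine ⟨_, h2, fun x => ⟨?_, ?_⟩⟩
  · cases χ x
    · exact Or.inr rfl
    · exact Or.inl rfl
  · rw [← h1]
    simp [Computability.encodeBool]

/-- The checked inverse is defined exactly on the image, so its verdict bit is the characteristic
function. -/
theorem mem_classP_of_ran {f : Str →. Str} (hf : f ∈ fP) (h : ¬ IsOneWay f) :
    ({y | y ∈ f.ran} : Set Str) ∈ ClassP := by
  have : ∃ g : Str →. Str, PolyTimeComputable g ∧ ∀ y ∈ f.ran, ∃ x ∈ g y, y ∈ f x := by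
    by_contra h'
    exact h ⟨hf, h'⟩
  obtain ⟨g, hg, hfg⟩ := this
  obtain ⟨g', hg', k, hk, hk', h1, h2⟩ := exists_inverse hf hg hfg
  refine ⟨fun y => (k y).isSome, h2, ?_⟩
  rw [detPolyTime_iff]
  convert PT.head.comp hk' using 2 with y
  cases k y <;> simp [encodeResult, Computability.encodeBool]

/-- An accepted language is the image of the map from accepting computations to inputs, which is in
`fP` and not one-way. -/
theorem classNP_subset_classP (h : ¬ ∃ f : Str →. Str, IsOneWay f) : ClassNP ⊆ ClassP := by
  rintro L ⟨N, hN, hL⟩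
  obtain ⟨B, hB⟩ := N.exists_length_choices_le
  have := mem_classP_of_ran (NTM.inputOf_mem_fP hN B) fun h' => h ⟨_, h'⟩
  refine (?_ : _ = L) ▸ this
  refine Set.ext fun x => Iff.trans ?_ (hL x)
  refine Iff.symm ?_
  constructor
  · intro hx
    obtain ⟨z, hz⟩ := NTM.exists_inputOf hB hx
    exact ⟨z, by simp [hz]⟩
  · rintro ⟨z, hz⟩
    exact NTM.accepts_of_inputOf (show N.inputOf B z = some x by simpa using hz)

/-! ### `P` is contained in `NP` -/

/-- Weaving and filtering each reverse the order, so the pairs come out in their original order. -/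
theorem filterPairs_weave (φ : Bool → Bool → Option Bool) (u c w x : Str)
    (h : c.length = u.length) : filterPairs φ (weave u c w) x =
      filterPairs φ w ((List.zipWith φ u c).reduceOption ++ x) := by
  induction u generalizing c w with
  | nil => simp [weave]
  | cons b u ih =>
    cases c with
    | nil => simp at h
    | cons a c =>
      rw [weave, ih _ _ (by simpa using h), filterPairs]
      cases h : φ b a <;> simp [h, List.reduceOption_cons_of_some, List.reduceOption_cons_of_none]

theorem filterPairs_weave_left (u c : Str) (h : c.length = u.length) :
    filterPairs (fun a _ => some a) (weave u c []) [] = u := by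
  rw [filterPairs_weave _ _ _ _ _ h]
  simp only [filterPairs, List.append_nil]
  induction u generalizing c with
  | nil => simp
  | cons b u ih =>
    cases c with
    | nil => simp at h
    | cons a c => simp [List.reduceOption_cons_of_some, ih c (by simpa using h)]

theorem filterPairs_weave_right (u c : Str) (h : c.length = u.length) :
    filterPairs (fun _ a => some a) (weave u c []) [] = c := by
  rw [filterPairs_weave _ _ _ _ _ h]
  simp only [filterPairs, List.append_nil]
  induction u generalizing c with
  | nil => simp at h; simp [h]
  | cons b u ih =>
    cases c with
    | nil => simp at h
    | cons a c => simp [List.reduceOption_cons_of_some, ih c (by simpa using h)]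

theorem classP_subset_classNP : ClassP ⊆ ClassNP := by
  intro L hL
  obtain ⟨h, hh, hL⟩ := pt_decide_of_classP hL
  have := guess_mem_classNP (hh.comp (PT.filterPairs fun a _ => some a))
  refine (?_ : _ = L) ▸ this
  refine Set.ext fun u => Iff.trans ?_ (hL u).2
  constructor
  · rintro ⟨c, hc, hu⟩
    rwa [filterPairs_weave_left u c hc] at hu
  · intro hu
    -- The verifier ignores the guess; any string of the right length would do.
    refine ⟨u, rfl, ?_⟩
    rwa [filterPairs_weave_left u u rfl]

/-! ### Encoding of several strings -/

/-- The bits of the first string, each with the tag `t`, reversed, on top of the second one. -/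
def tagAll (t : Bool) : Str → Str → Str
  | [], w => w
  | b :: x, w => tagAll t x (t :: b :: w)

theorem tagAll_append (t : Bool) (x w w' : Str) : tagAll t x w ++ w' = tagAll t x (w ++ w') := by
  induction x generalizing w with
  | nil => rfl
  | cons b x ih => simp [tagAll, ih]

theorem length_tagAll (t : Bool) (x w : Str) :
    (tagAll t x w).length = 2 * x.length + w.length := by
  induction x generalizing w with
  | nil => simp [tagAll]
  | cons b x ih => rw [tagAll, ih]; simp; ring

theorem filterPairs_tagAll (t : Bool) (x w z : Str) :
    filterPairs (sel t) (tagAll t x w) z = filterPairs (sel t) w (x ++ z) := by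
  induction x generalizing w with
  | nil => rfl
  | cons b x ih => rw [tagAll, ih]; simp [filterPairs, sel]

theorem filterPairs_tagAll_of_ne {t t' : Bool} (h : t' ≠ t) (x w z : Str) :
    filterPairs (sel t) (tagAll t' x w) z = filterPairs (sel t) w z := by
  induction x generalizing w with
  | nil => rfl
  | cons b x ih => rw [tagAll, ih]; simp [filterPairs, sel, h]

/-- Filler zeros are read as pairs with tag `false`, and an odd last symbol is dropped, so a guess
can be filled up to any length. -/
theorem filterPairs_replicate_false (k : ℕ) (z : Str) :
    filterPairs (sel true) (List.replicate k false) z = z := by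
  induction k using Nat.twoStepInduction with
  | zero => rfl
  | one => rfl
  | more k ih _ => simpa [List.replicate_succ, filterPairs, sel] using ih

theorem PT.tagAll (t : Bool) : PT fun x => tagAll t x [] := by
  have main := Tr.loop (0 : Fin 8) (s := fun b : Str × Str => st b.1 b.2 [] [] [] [] [] [])
    (fun b => (b.1.tail, t :: b.1.head?.getD false :: b.2))
    (fun b => ([], PolyFun.tagAll t b.1 b.2)) ?_ ?_ ?_ ?_ (fun b => 2 * b.1.length + b.2.length)
    ?_ ?_ (2 * X) ?_
  · refine PT.of_tr_st (((((main.comap fun z : Str => (z, [])).mono fun _ _ => trivial).trans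
      (Tr.moveRev _ _ (r := 1) (q := 2) (by decide))).trans
      (Tr.moveRev _ _ (r := 2) (q := 0) (by decide))).to_eq (by simp))
  · refine Tr.casesBool 0 ?_ fun a => ?_
    · exact (Tr.refl _ _).congr (fun _ h => h) (fun _ _ => rfl) fun a ha => absurd ha.2 ha.1
    · refine (((Tr.pop _ _ 0).trans (Tr.push _ _ 1 a)).trans (Tr.push _ _ 1 t)).to_eq fun b hb => ?_
      simp at hb
      simp [hb]
  · rintro ⟨z, x⟩ h
    simp at h
    simp [h, PolyFun.tagAll]
  · rintro ⟨z, x⟩ h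
    cases z with
    | nil => simp at h
    | cons b z => simp [PolyFun.tagAll]
  · rintro ⟨z, x⟩ h
    cases z with
    | nil => simp at h
    | cons b z => simp
  · rintro ⟨z, x⟩
    simp [size_st]
    omega
  · rintro ⟨z, x⟩ h
    cases z with
    | nil => simp at h
    | cons b z => simp; omega
  · rintro ⟨z, x⟩
    simp [size_st]
    omega

/-! ### Padding -/

/-- Put a copy of `x`, and four more bits, on top of `w` for each bit of another string. -/
def mulLength (x : Str) : Str → Str → Str
  | [], w => w
  | _ :: c, w => mulLength x c (true :: true :: true :: true :: (x ++ w))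

theorem length_mulLength (x c w : Str) :
    (mulLength x c w).length = c.length * (x.length + 4) + w.length := by
  induction c generalizing w with
  | nil => simp [mulLength]
  | cons b c ih => rw [mulLength, ih]; simp; ring

theorem PT.mulLength : PT fun x => mulLength x x [true, true] := by
  have main := Tr.loop (1 : Fin 8)
    (s := fun b : Str × Str × Str => st b.1 b.2.1 [] b.2.2 [] [] [] [])
    (fun b => (b.1, b.2.1.tail, true :: true :: true :: true :: (b.1 ++ b.2.2)))
    (fun b => (b.1, [], PolyFun.mulLength b.1 b.2.1 b.2.2)) ?_ ?_ ?_ ?_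
    -- A round appends `|x| + 4` symbols to `w` and shortens `c` by one, so this measure drops by
    -- one.
    (fun b => b.1.length + b.2.1.length * (b.1.length + 5) + b.2.2.length)
    ?_ ?_ (X * (X + 7)) ?_
  · refine PT.of_tr_st (Tr.trans ?_ (((((main.comap fun x : Str => (x, x, [true, true])).mono
      fun _ _ => trivial).trans (Tr.clear _ _ 0)).trans
      (Tr.moveRev _ _ (r := 3) (q := 2) (by decide))).trans
      (Tr.moveRev _ _ (r := 2) (q := 0) (by decide)) |>.to_eq (by simp)))
    exact (((Tr.copy _ _ (r := 0) (q := 1) (t := 2) (by decide) (by decide) (by decide)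
      (by simp)).trans (Tr.push _ _ 3 true)).trans (Tr.push _ _ 3 true)).to_eq (by simp)
  · refine (((((Tr.pop _ _ 1).trans (Tr.copy _ _ (r := 0) (q := 3) (t := 2) (by decide) (by decide)
      (by decide) (by simp))).trans (Tr.push _ _ 3 true)).trans (Tr.push _ _ 3 true)).trans
      (Tr.push _ _ 3 true)).trans (Tr.push _ _ 3 true) |>.to_eq (by simp)
  · rintro ⟨x, c, w⟩ h
    simp at h
    simp [h, PolyFun.mulLength]
  · rintro ⟨x, c, w⟩ h
    cases c with
    | nil => simp at h
    | cons b c => simp [PolyFun.mulLength]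
  · rintro ⟨x, c, w⟩ h
    cases c with
    | nil => simp at h
    | cons b c => simp
  · rintro ⟨x, c, w⟩
    simp [size_st]
    nlinarith
  · rintro ⟨x, c, w⟩ h
    cases c with
    | nil => simp at h
    | cons b c => simp; ring_nf; omega
  · rintro ⟨x, c, w⟩
    simp [size_st]
    nlinarith

/-- The length of `mulLength x x [true, true]` is `|x| (|x| + 4) + 2`, that is, `(|x| + 2) ^ 2 - 2`.
Each iteration therefore squares the length plus two. -/
theorem exists_pt_pow_le (k : ℕ) :
    ∃ h : Str → Str, PT h ∧ ∀ x, (x.length + 2) ^ 2 ^ k ≤ (h x).length + 2 := by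
  induction k with
  | zero => exact ⟨_, PT.cons true, fun x => by simp⟩
  | succ k ih =>
    obtain ⟨h, hh, hk⟩ := ih
    refine ⟨_, PT.mulLength.comp hh, fun x => ?_⟩
    rw [length_mulLength, pow_succ, pow_mul]
    refine (Nat.pow_le_pow_left (hk x) 2).trans ?_
    simp
    nlinarith

/-- The base is at least 2, so one more factor absorbs a sum, and a coefficient `c` is absorbed by
`c ≤ 2 ^ c`. -/
theorem exists_eval_le_pow (q : ℕ[X]) : ∃ k, ∀ n, q.eval n ≤ (n + 2) ^ k := by
  induction q using Polynomial.induction_on' with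
  | add p q hp hq =>
    obtain ⟨a, ha⟩ := hp
    obtain ⟨b, hb⟩ := hq
    refine ⟨a + b + 1, fun n => ?_⟩
    rw [eval_add]
    have h1 : (n + 2) ^ a ≤ (n + 2) ^ (a + b) := Nat.pow_le_pow_right (by omega) (by omega)
    have h2 : (n + 2) ^ b ≤ (n + 2) ^ (a + b) := Nat.pow_le_pow_right (by omega) (by omega)
    have h3 : (n + 2) ^ (a + b) * 2 ≤ (n + 2) ^ (a + b + 1) := by
      rw [pow_succ]
      exact Nat.mul_le_mul_left _ (by omega)
    have := ha n
    have := hb n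
    omega
  | monomial d c =>
    refine ⟨c + d, fun n => ?_⟩
    rw [eval_monomial, pow_add]
    refine Nat.mul_le_mul ?_ (Nat.pow_le_pow_left (by omega) d)
    exact (Nat.lt_two_pow_self).le.trans (Nat.pow_le_pow_left (by omega) c)

theorem exists_pt_eval_le (q : ℕ[X]) :
    ∃ h : Str → Str, PT h ∧ ∀ x, q.eval x.length ≤ (h x).length := by
  -- The summand 2 makes up for the shift in `exists_pt_pow_le`.
  obtain ⟨k, hk⟩ := exists_eval_le_pow (q + 2)
  obtain ⟨h, hh, hx⟩ := exists_pt_pow_le k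
  refine ⟨h, hh, fun x => ?_⟩
  have h1 := hk x.length
  have h2 : (x.length + 2) ^ k ≤ (x.length + 2) ^ 2 ^ k :=
    Nat.pow_le_pow_right (by omega) (Nat.lt_two_pow_self).le
  have h3 := hx x
  simp at h1
  omega

/-! ### `P = NP` implies that `fP` is regular -/

/-- The encoding of an image `y`, a reversed prefix `z` of a preimage, and padding `p`. -/
def query (y z p : Str) : Str :=
  tagAll true y (tagAll false (tagAll true z (tagAll false p [])) [])

/-- The image in a string `w` that consists of a query and a guess. -/
def queryImage (w : Str) : Str :=
  filterPairs (sel true) (filterPairs (fun a _ => some a) w []) []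

/-- The reversed prefix in a string `w` that consists of a query and a guess. -/
def queryPrefix (w : Str) : Str :=
  filterPairs (sel true) (filterPairs (sel false) (filterPairs (fun a _ => some a) w []) []) []

/-- The guessed suffix in a string `w` that consists of a query and a guess. -/
def guessedSuffix (w : Str) : Str :=
  filterPairs (sel true) (filterPairs (fun _ a => some a) w []) []

/-- This is the verifier of the `NP` language used for inversion: the prefix from the query,
completed by the guessed suffix, must be mapped to the image from the query. -/
theorem PT.checkQuery {f : Str → Option Str} (hf : PT fun x => encodeResult (f x)) :
    PT fun w => [decide (f ((queryPrefix w).reverse ++ guessedSuffix w) = some (queryImage w))] := by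
  have hl := (PT.filterPairs fun a _ => some a).sloppy
  have hr := (PT.filterPairs fun _ a => some a).sloppy
  have h1 := (PT.filterPairs (sel true)).sloppy
  have h0 := (PT.filterPairs (sel false)).sloppy
  refine PT.of_tr_st (Tr.trans (t := fun w => st (queryImage w)
    ((queryPrefix w).reverse ++ guessedSuffix w) [] [] [] [] [] []) ?_ (Tr.checkImage hf _ _ _ _))
  refine (Tr.copy _ _ (r := 0) (q := 1) (t := 2) (by decide) (by decide) (by decide)
    (by simp)).trans ?_
  refine (Tr.call hr _ _ (r := 1) (t := 2) (by decide) (by simp)).trans ?_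
  refine (Tr.call h1 _ _ (r := 1) (t := 2) (by decide) (by simp)).trans ?_
  refine (Tr.call hl _ _ (r := 0) (t := 2) (by decide) (by simp)).trans ?_
  refine (Tr.copy _ _ (r := 0) (q := 3) (t := 2) (by decide) (by decide) (by decide)
    (by simp)).trans ?_
  refine (Tr.call h1 _ _ (r := 0) (t := 2) (by decide) (by simp)).trans ?_
  refine (Tr.call h0 _ _ (r := 3) (t := 2) (by decide) (by simp)).trans ?_
  refine (Tr.call h1 _ _ (r := 3) (t := 2) (by decide) (by simp)).trans ?_
  refine (Tr.moveRev _ _ (r := 3) (q := 1) (by decide)).to_eq ?_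
  simp [queryImage, queryPrefix, guessedSuffix]

/-- Form a query in the register 6. -/
theorem Tr.query {α : Type} (D : α → Prop) (y z c p : α → Str) :
    Tr D (fun a => st (y a) (z a) [] (c a) (p a) [] [] [])
      fun a => st (y a) (z a) [] (c a) (p a) [] (query (y a) (z a) (p a)) [] := by
  have h1 := (PT.tagAll true).sloppy
  have h0 := (PT.tagAll false).sloppy
  refine (Tr.copy _ _ (r := 1) (q := 5) (t := 2) (by decide) (by decide) (by decide)
    (by simp)).trans ?_
  refine (Tr.call h1 _ _ (r := 5) (t := 2) (by decide) (by simp)).trans ?_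
  refine (Tr.copy _ _ (r := 4) (q := 6) (t := 2) (by decide) (by decide) (by decide)
    (by simp)).trans ?_
  refine (Tr.call h0 _ _ (r := 6) (t := 2) (by decide) (by simp)).trans ?_
  refine (Tr.moveRev _ _ (r := 5) (q := 2) (by decide)).trans ?_
  refine (Tr.moveRev _ _ (r := 2) (q := 6) (by decide)).trans ?_
  refine (Tr.call h0 _ _ (r := 6) (t := 2) (by decide) (by simp)).trans ?_
  refine (Tr.copy _ _ (r := 0) (q := 5) (t := 2) (by decide) (by decide) (by decide)
    (by simp)).trans ?_
  refine (Tr.call h1 _ _ (r := 5) (t := 2) (by decide) (by simp)).trans ?_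
  refine (Tr.moveRev _ _ (r := 5) (q := 2) (by decide)).trans ?_
  refine (Tr.moveRev _ _ (r := 2) (q := 6) (by decide)).to_eq ?_
  simp [PolyFun.query, tagAll_append]

/-- Extend a reversed prefix of a preimage by one bit, if possible. -/
def extend (h : Str → Str) (y p z : Str) : Str :=
  if h (query y (false :: z) p) = [true] then false :: z
  else if h (query y (true :: z) p) = [true] then true :: z else z

/-- Extend a reversed prefix of a preimage as many times as the last string has bits. -/
def search (h : Str → Str) (y p : Str) : Str → Str → Str
  | z, [] => z
  | z, _ :: c => search h y p (extend h y p z) c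

/-- An oracle call: the query is formed in register 6, decided there and erased, so that both
branches continue from the original registers. -/
theorem Tr.ask {α : Type} {h : Str → Str} (hh : PT h)
    (hb : ∀ x, h x = [true] ∨ h x = [false]) (D : α → Prop) (y z c p : α → Str) (t : α → Fin 8 → Str)
    (hD : Tr (fun a => D a ∧ h (PolyFun.query (y a) (z a) (p a)) = [true])
      (fun a => st (y a) (z a) [] (c a) (p a) [] [] []) t)
    (hD' : Tr (fun a => D a ∧ h (PolyFun.query (y a) (z a) (p a)) ≠ [true])
      (fun a => st (y a) (z a) [] (c a) (p a) [] [] []) t) :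
    Tr D (fun a => st (y a) (z a) [] (c a) (p a) [] [] []) t := by
  refine (Tr.query D y z c p).trans ((Tr.call hh.sloppy _ _ (r := 6) (t := 2) (by decide)
    (by simp)).trans (Tr.casesBool 6 ?_ fun b => ?_))
  · refine (Tr.refl _ _).congr (fun _ h => h) (fun _ _ => rfl) fun a ha => ?_
    simp at ha
    have := hb (PolyFun.query (y a) (z a) (p a))
    simp [ha] at this
  · have hc : ∀ a, (D a ∧ (Function.update (st (y a) (z a) [] (c a) (p a) []
        (PolyFun.query (y a) (z a) (p a)) []) 6 (h (st (y a) (z a) [] (c a) (p a) []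
        (PolyFun.query (y a) (z a) (p a)) [] 6)) 6).head? = some b) →
        D a ∧ h (PolyFun.query (y a) (z a) (p a)) = [b] := by
      rintro a ⟨ha, ha'⟩
      simp at ha'
      refine ⟨ha, ?_⟩
      rcases hb (PolyFun.query (y a) (z a) (p a)) with h | h <;> rw [h] at ha' <;> simpa [h] using ha'
    refine ((Tr.clear _ _ 6).to_eq (t' := fun a => st (y a) (z a) [] (c a) (p a) [] [] [])
      (by simp)).trans ?_
    cases b
    · exact hD'.mono fun a ha => ⟨(hc a ha).1, by rw [(hc a ha).2]; simp⟩
    · exact hD.mono hc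

theorem Tr.extend {α : Type} {h : Str → Str} (hh : PT h)
    (hb : ∀ x, h x = [true] ∨ h x = [false]) (D : α → Prop) (y z c p : α → Str) :
    Tr D (fun a => st (y a) (z a) [] (c a) (p a) [] [] [])
      fun a => st (y a) (extend h (y a) (p a) (z a)) [] (c a) (p a) [] [] [] := by
  refine ((Tr.push _ _ 1 false).to_eq (t' := fun a => st (y a) (false :: z a) [] (c a) (p a) [] [] [])
    (by simp)).trans (Tr.ask hh hb _ _ _ _ _ _ ?_ ?_)
  · refine (Tr.refl _ _).to_eq fun a ha => ?_
    simp [PolyFun.extend, ha.2]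
  · refine (((Tr.pop _ _ 1).trans (Tr.push _ _ 1 true)).to_eq
      (t' := fun a => st (y a) (true :: z a) [] (c a) (p a) [] [] [])
      (by simp)).trans (Tr.ask hh hb _ _ _ _ _ _ ?_ ?_)
    · refine (Tr.refl _ _).to_eq fun a ha => ?_
      simp [PolyFun.extend, ha.1.2, ha.2]
    · refine (Tr.pop _ _ 1).to_eq fun a ha => ?_
      simp [PolyFun.extend, ha.1.2, ha.2]

theorem length_extend_le (h : Str → Str) (y p z : Str) :
    (extend h y p z).length ≤ z.length + 1 := by
  unfold extend
  split_ifs <;> simp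

theorem PT.search {h pad : Str → Str} (hh : PT h) (hb : ∀ x, h x = [true] ∨ h x = [false])
    (hpad : PT pad) :
    PT fun y => true :: (search h y (pad y) [] (pad y)).reverse := by
  have main := Tr.loop (3 : Fin 8)
    -- Registers 0 and 4 keep the image and the padding; 1 holds the reversed prefix, and 3 counts
    -- the remaining rounds.
    (s := fun b : (Str × Str) × Str × Str => st b.1.1 b.2.1 [] b.2.2 b.1.2 [] [] [])
    (fun b => (b.1, PolyFun.extend h b.1.1 b.1.2 b.2.1, b.2.2.tail))
    (fun b => (b.1, PolyFun.search h b.1.1 b.1.2 b.2.1 b.2.2, [])) ?_ ?_ ?_ ?_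
    (fun b => b.1.1.length + b.2.1.length + b.2.2.length + b.1.2.length)
    ?_ ?_ X ?_
  · refine PT.of_tr_st (Tr.trans (t := fun y => st y [] [] (pad y) (pad y) [] [] []) ?_
      (((main.comap fun y : Str => ((y, pad y), [], pad y)).mono fun _ _ => trivial).trans
      ((Tr.clear _ _ 0).trans ((Tr.clear _ _ 4).trans ((Tr.moveRev _ _ (r := 1) (q := 0)
      (by decide)).trans ((Tr.push _ _ 0 true).to_eq (by simp)))))))
    exact (((Tr.copy _ _ (r := 0) (q := 3) (t := 2) (by decide) (by decide) (by decide)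
      (by simp)).trans (Tr.call hpad.sloppy _ _ (r := 3) (t := 2) (by decide) (by simp))).trans
      (Tr.copy _ _ (r := 3) (q := 4) (t := 2) (by decide) (by decide) (by decide)
      (by simp))).to_eq (by simp)
  · exact (Tr.extend hh hb _ _ _ _ _).trans (Tr.pop _ _ 3) |>.to_eq (by simp)
  · rintro ⟨⟨y, p⟩, z, c⟩ hc
    simp at hc
    simp [hc, PolyFun.search]
  · rintro ⟨⟨y, p⟩, z, c⟩ hc
    cases c with
    | nil => simp at hc
    | cons b c => simp [PolyFun.search]
  · rintro ⟨⟨y, p⟩, z, c⟩ hc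
    cases c with
    | nil => simp at hc
    | cons b c => simp
  · rintro ⟨⟨y, p⟩, z, c⟩
    simp [size_st]
  · rintro ⟨⟨y, p⟩, z, c⟩ hc
    have := length_extend_le h y p z
    cases c with
    | nil => simp at hc
    | cons b c => simp; omega
  · rintro ⟨⟨y, p⟩, z, c⟩
    simp [size_st]

/-- The invariant is that the current prefix extends to a preimage. If neither one-bit extension
does, the prefix itself is a preimage and no later round changes it. Otherwise it grows in every
round, which the length bound stops before the counter is used up. -/
theorem search_correct {f : Str → Option Str} {h : Str → Str} {y p : Str} {n : ℕ}
    (hn : ∀ x, f x = some y → x.length < n)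
    (hq : ∀ z, h (query y z p) = [true] ↔ ∃ e, f (z.reverse ++ e) = some y) (z c : Str)
    (hc : n ≤ z.length + c.length) (hz : ∃ e, f (z.reverse ++ e) = some y) :
    f (search h y p z c).reverse = some y := by
  induction c generalizing z with
  | nil =>
    -- With no rounds left, the prefix would have length at least `n`, against the strict bound on
    -- preimages.
    obtain ⟨e, he⟩ := hz
    have := hn _ he
    simp at this hc
    omega
  | cons b c ih =>
    rw [search]
    by_cases h0 : h (query y (false :: z) p) = [true]
    · have e1 : extend h y p z = false :: z := by simp [extend, h0]
      rw [e1]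
      exact ih _ (by simp at hc ⊢; omega) ((hq _).1 h0)
    by_cases h1 : h (query y (true :: z) p) = [true]
    · have e1 : extend h y p z = true :: z := by simp [extend, h0, h1]
      rw [e1]
      exact ih _ (by simp at hc ⊢; omega) ((hq _).1 h1)
    · have e1 : extend h y p z = z := by simp [extend, h0, h1]
      have e2 : ∀ c, search h y p z c = z := by
        intro c
        induction c with
        | nil => rfl
        | cons b c ih => rw [search, e1, ih]
      rw [e1, e2]
      obtain ⟨e, he⟩ := hz
      cases e with
      | nil => simpa using he
      | cons d e =>
        have : ∃ e, f ((d :: z).reverse ++ e) = some y := ⟨e, by simpa using he⟩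
        cases d
        · exact (h0 ((hq _).2 this)).elim
        · exact (h1 ((hq _).2 this)).elim

/-- The query is at least four times as long as `p`, while a tagged suffix takes two symbols per
bit; hence every suffix of a preimage fits into a guess of the length of the query. -/
theorem query_guess_iff {f : Str → Option Str} {y p : Str} (z : Str)
    (hp : ∀ x, f x = some y → x.length ≤ p.length) :
    (∃ c : Str, c.length = (query y z p).length ∧ [decide (f ((queryPrefix
      (weave (query y z p) c [])).reverse ++ guessedSuffix (weave (query y z p) c [])) =
      some (queryImage (weave (query y z p) c [])))] = [true]) ↔
    ∃ e, f (z.reverse ++ e) = some y := by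
  have h1 : ∀ c : Str, c.length = (query y z p).length →
      queryImage (weave (query y z p) c []) = y ∧
      queryPrefix (weave (query y z p) c []) = z ∧
      guessedSuffix (weave (query y z p) c []) = filterPairs (sel true) c [] := by
    intro c hc
    unfold queryImage queryPrefix guessedSuffix
    rw [filterPairs_weave_left _ _ hc, filterPairs_weave_right _ _ hc]
    unfold query
    rw [filterPairs_tagAll, filterPairs_tagAll_of_ne (by decide), filterPairs_tagAll_of_ne
      (by decide), filterPairs_tagAll]
    simp only [filterPairs, List.append_nil]
    rw [filterPairs_tagAll, filterPairs_tagAll_of_ne (by decide)]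
    simp [filterPairs]
  constructor
  · rintro ⟨c, hc, h⟩
    obtain ⟨e1, e2, e3⟩ := h1 c hc
    rw [e1, e2, e3] at h
    exact ⟨_, by simpa using h⟩
  · rintro ⟨e, he⟩
    have hle := hp _ he
    have hlen : (query y z p).length = 2 * y.length + 2 * (2 * z.length + 2 * p.length) := by
      simp [query, length_tagAll]
    -- The guess is the tagged suffix, filled up with zeros to the length of the query.
    have hc : (tagAll true e (List.replicate ((query y z p).length - 2 * e.length) false)).length
        = (query y z p).length := by
      rw [length_tagAll, List.length_replicate]
      simp at hle
      omega
    refine ⟨_, hc, ?_⟩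
    obtain ⟨e1, e2, e3⟩ := h1 _ hc
    rw [e1, e2, e3, filterPairs_tagAll, filterPairs_replicate_false]
    simpa using he

theorem not_isOneWay_of_classP_eq (h : ClassP = ClassNP) (f : Str →. Str) : ¬ IsOneWay f := by
  rintro ⟨hf, hinv⟩
  obtain ⟨⟨_, q, hb⟩, f₀, hf₀, hf₁⟩ := (mem_fP_iff f).1 hf
  have hb' : ∀ x y, f₀ x = some y → x.length < (q + 1).eval y.length := by
    intro x y hx
    have := (hb x y (by rw [hf₀, hx]; simp)).2
    rw [eval_add, eval_one]
    omega
  obtain ⟨d, hd, hL⟩ := pt_decide_of_classP (h ▸ guess_mem_classNP (PT.checkQuery hf₁))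
  -- The same padding serves inside the queries and as round counter; the summand 1 gives the strict
  -- bound that the search needs.
  obtain ⟨pad, hpad, hpad'⟩ := exists_pt_eval_le (q + 1)
  refine hinv ⟨fun y => (some (search d y (pad y) [] (pad y)).reverse : Option Str),
    ⟨_, fun _ => rfl, ?_⟩, fun y hy => ⟨(search d y (pad y) [] (pad y)).reverse, by simp, ?_⟩⟩
  · rw [detPolyTime_iff]
    exact PT.search hd (fun x => (hL x).1) hpad
  · rw [hf₀, search_correct (f := f₀) (y := y) (n := (q + 1).eval y.length) (fun x => hb' x y)]
    · simp
    · intro z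
      rw [← query_guess_iff z fun x hx => (hb' x y hx).le.trans (hpad' y)]
      exact (hL _).2
    · simpa using hpad' y
    · obtain ⟨x, hx⟩ := hy
      rw [hf₀] at hx
      exact ⟨x, by simpa using hx⟩

end PolyFun

/-- The set `fP` is a submonoid of the monoid of partial functions on binary strings; it is
regular iff there are no one-way functions, and iff `P = NP`; and its non-regular elements are
exactly the one-way functions. -/
theorem mainTheorem1 :
    ∃ M : Submonoid (PolyFun.Str →. PolyFun.Str), (M : Set (PolyFun.Str →. PolyFun.Str)) = PolyFun.fP ∧
      (PolyFun.IsRegularSemigroup M ↔ ¬ ∃ f : PolyFun.Str →. PolyFun.Str, PolyFun.IsOneWay f) ∧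
      (PolyFun.IsRegularSemigroup M ↔ PolyFun.ClassP = PolyFun.ClassNP) ∧
      (∀ f : PolyFun.Str →. PolyFun.Str,
        (∃ hf : f ∈ M, ¬ PolyFun.IsRegularElement (⟨f, hf⟩ : M)) ↔ PolyFun.IsOneWay f) := by
  refine ⟨PolyFun.fPSubmonoid, rfl, PolyFun.isRegularSemigroup_iff,
    PolyFun.isRegularSemigroup_iff.trans ⟨fun h => ?_, fun h => ?_⟩, fun f => ⟨?_, fun hf => ?_⟩⟩
  · exact PolyFun.classP_subset_classNP.antisymm (PolyFun.classNP_subset_classP h)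
  · rintro ⟨f, hf⟩
    exact PolyFun.not_isOneWay_of_classP_eq h f hf
  · rintro ⟨hf, h⟩
    by_contra h'
    exact h ((PolyFun.isRegularElement_iff hf).2 h')
  · exact ⟨hf.1, fun h => (PolyFun.isRegularElement_iff hf.1).1 h hf⟩
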